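/- Let $\mathcal A$ be a category with a zero object, kernels and cokernels. An arrow of $\mathcal A$ is called proper if its factorization through the kernel of its cokernel is a regular epimorphism. A ($\mathbb Z$-indexed) chain complex is called proper if all its differentials are proper. A sequence $X\xrightarrow{f}Y\xrightarrow{g}Z$ is exact at $Y$ if $g f=0$ and the factorization of $f$ through the kernel of $g$ is a regular epimorphism. A sequentiable family $h_\bullet$ consists of arrows $h_n\colon \mathrm{Dom}(h_n)\to\mathrm{Cod}(h_n)$ and $i_n\colon\mathrm{Cok}(h_{n+1})\to\mathrm{Ker}(h_n)$, $n\in\mathbb Z$; a morphism $h_\bullet\to h'_\bullet$ is a family of pairs of arrows between domains and codomains compatible with the $h_n$ and the $i_n$; a nullhomotopy of such a morphism $(\overline f_n,\underline f_n)$ is a family $\lambda_n\colon\mathrm{Cod}(h_n)\to\mathrm{Dom}(h'_n)$ with $\lambda_n h_n=\overline f_n$ and $h'_n\lambda_n=\underline f_n$. A chain complex $C$ gives the sequentiable family $\mathcal F(C)$ with $h^C_n\colon\mathrm{Cok}(d^C_{n+1})\to\mathrm{Ker}(d^C_{n-1})$ induced by $d^C_n$ and with $i_n$ induced by $\mathrm{Ker}(d^C_n)\to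 C_n\to\mathrm{Cok}(d^C_{n+1})$; this is functorial in $C$. For a morphism of complexes $g\colon B\to C$, the homotopy kernel (with respect to these nullhomotopies) $\mathcal N(\mathcal F(g))$ of $\mathcal F(g)$ consists of the arrows $$h^P_n=\langle h^B_n,\overline{\mathcal F g}_n\rangle\colon \mathrm{Cok}(d^B_{n+1})\to P_n=\mathrm{Ker}(d^B_{n-1})\times_{\mathrm{Ker}(d^C_{n-1})}\mathrm{Cok}(d^C_{n+1})$$ with the induced connecting arrows; it is called proper if all the $h^P_n$ are proper. 1. Let $\mathcal A$ be moreover regular (in particular finitely complete) and protomodular, let $g\colon B\to C$ be a morphism of proper complexes, and assume that $\mathcal N(\mathcal F(g))$ is proper. Then the homology objects $H_n(B)$, $H_n(C)$ exist (the cokernel of $B_{n+1}\to\mathrm{Ker}(d^B_n)$ is canonically isomorphic to the kernel of $\mathrm{Cok}(d^B_{n+1})\to B_{n-1}$, and likewise for $C$), and the long sequence $$\cdots\to H_{n+1}(B)\xrightarrow{H_{n+1}(g)} H_{n+1}(C)\xrightarrow{\delta_{n+1}}\mathrm{Cok}(h^P_{n+1})\xrightarrow{\varepsilon_n} H_n(B)\xrightarrow{H_n(g)}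 H_n(C)\to\cdots$$ is exact at every place, where $\delta_{n+1}$ is the composite of $\langle 0,k\rangle\colon H_{n+1}(C)\to P_{n+1}$ ($k$ being the inclusion of $H_{n+1}(C)$ in $\mathrm{Cok}(d^C_{n+2})$) with the projection to the cokernel, and $\varepsilon_n$ is induced by the projection $P_{n+1}\to\mathrm{Ker}(d^B_n)$. 2. In the situation of 1, suppose that $g$ is part of an extension $X\xrightarrow{f}B\xrightarrow{g}C$ of proper complexes (in each degree $f$ is a kernel of $g$ and $g$ is a cokernel of $f$). Then the homology objects $H_n(X)$ exist and the comparison $\mathcal F(X)\to\mathcal N(\mathcal F(g))$ induces isomorphisms $e_n\colon H_n(X)\cong\mathrm{Cok}(h^P_{n+1})$ with $\varepsilon_n e_n=H_n(f)$. Moreover, the classical connecting arrow $\partial\colon H_{n+1}(C)\to H_n(X)$ of the extension exists (the unique arrow that sends a class $c$ to the class of a cycle $a$ whenever $c$ lifts to $b$ in $\mathrm{Cok}(d^B_{n+2})$ and $f(a)$ is the boundary of $b$), and $e_n\partial$ and $\delta_{n+1}$ are mutually inverse, in the sense that there is an arrow $H_{n+1}(C)\times H_{n+1}(C)\to\mathrm{Cok}(h^P_{n+1})$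 which restricts to $e_n\partial$ and to $\delta_{n+1}$ on the two factors and to $0$ on the diagonal. 3. If $\mathcal A$ is abelian, the long sequence in 1 is exact at every place for every morphism $g\colon B\to C$ of chain complexes, with no properness hypothesis. If moreover $0\to X\xrightarrow{f}B\xrightarrow{g}C\to0$ is a short exact sequence of complexes, the comparison $\mathcal F(X)\to\mathcal N(\mathcal F(g))$ induces isomorphisms $e_n\colon H_n(X)\cong\mathrm{Cok}(h^P_{n+1})$ with $\varepsilon_n e_n=H_n(f)$ and $e_n\partial=-\delta_{n+1}$, where $\partial\colon H_{n+1}(C)\to H_n(X)$ is the usual connecting morphism; so, up to the sign of the connecting morphisms, the long sequence is the classical long homology sequence of the extension. -/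

import Mathlib

open CategoryTheory CategoryTheory.Limits

universe v u

namespace SnailHomology

/-! ### Protomodular categories -/

/-- Protomodularity in the sense of Bourn: for every `v : E ⟶ B`, pulling back along `v`, as a
functor from the points (split epimorphisms with a chosen section) over `B` to the points over
`E`, reflects isomorphisms. The morphism `f` below is a morphism of points over `B` from
`(p, s)` to `(p', s')`. -/
class Protomodular (A : Type u) [Category.{v} A] [HasPullbacks A] : Prop where
  isIso_of_isIso_pullback : ∀ {E B X X' : A} (v : E ⟶ B) (p : X ⟶ B) (s : B ⟶ X)
    (p' : X' ⟶ B) (s' : B ⟶ X') (f : X ⟶ X'), s ≫ p = 𝟙 B → s' ≫ p' = 𝟙 B →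
    ∀ (hp : f ≫ p' = p), s ≫ f = s' →
    IsIso (pullback.map p v p' v f (𝟙 E) (𝟙 B) (by simp [hp]) (by simp)) → IsIso f

section

variable {A : Type u} [Category.{v} A] [HasZeroMorphisms A]

/-! ### Proper arrows and exactness -/

/-- An arrow is proper if its factorization through the kernel of its cokernel is a regular
epimorphism. -/
def IsProperArrow [HasKernels A] [HasCokernels A] {X Y : A} (f : X ⟶ Y) : Prop :=
  IsRegularEpi (kernel.lift (cokernel.π f) f (cokernel.condition f))

/-- A complex is proper if all its differentials are proper arrows. -/
def IsProperComplex [HasKernels A] [HasCokernels A] (C : ChainComplex A ℤ) : Prop :=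
  ∀ n : ℤ, IsProperArrow (C.d (n + 1) n)

/-- Exactness of `X ⟶ Y ⟶ Z` at `Y`: the composite is zero and the factorization of `f` through
the kernel of `g` is a regular epimorphism. -/
def IsExactAt [HasKernels A] {X Y Z : A} (f : X ⟶ Y) (g : Y ⟶ Z) : Prop :=
  ∃ w : f ≫ g = 0, IsRegularEpi (kernel.lift g f w)

/-- An extension `X ⟶ Y ⟶ Z` of complexes: in each degree the first arrow is a kernel of the
second one and the second arrow is a cokernel of the first one. -/
def IsExtension {X Y Z : ChainComplex A ℤ} (f : X ⟶ Y) (g : Y ⟶ Z) : Prop :=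
  ∀ n : ℤ, ∃ w : f.f n ≫ g.f n = 0,
    Nonempty (IsLimit (KernelFork.ofι (f.f n) w)) ∧
    Nonempty (IsColimit (CokernelCofork.ofπ (g.f n) w))

/-- Two arrows `a b : Z ⟶ W` are mutually inverse if there is an arrow `φ : Z ⨯ Z ⟶ W`
("`(z, z') ↦ a z + b z'`") restricting to `a` and to `b` on the two factors and to zero on the
diagonal. In an additive category this means `b = - a`. -/
def AreMutuallyInverse [HasBinaryProducts A] {Z W : A} (a b : Z ⟶ W) : Prop :=
  ∃ φ : Z ⨯ Z ⟶ W, prod.lift (𝟙 Z) 0 ≫ φ = a ∧ prod.lift 0 (𝟙 Z) ≫ φ = b ∧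
    prod.lift (𝟙 Z) (𝟙 Z) ≫ φ = 0

end

/-! ### Sequentiable families of arrows -/

/-- A sequentiable family of arrows: arrows `h n : dom n ⟶ cod n` together with connecting arrows
from the cokernel of `h (n + 1)` to the kernel of `h n`. -/
structure SeqFamily (A : Type u) [Category.{v} A] [HasZeroMorphisms A] [HasKernels A]
    [HasCokernels A] where
  dom : ℤ → A
  cod : ℤ → A
  h : ∀ n : ℤ, dom n ⟶ cod n
  i : ∀ n : ℤ, cokernel (h (n + 1)) ⟶ kernel (h n)

namespace SeqFamily

variable {A : Type u} [Category.{v} A] [HasZeroMorphisms A] [HasKernels A] [HasCokernels A]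

/-- Morphisms of sequentiable families. -/
@[ext]
structure Hom (x y : SeqFamily A) where
  dom : ∀ n : ℤ, x.dom n ⟶ y.dom n
  cod : ∀ n : ℤ, x.cod n ⟶ y.cod n
  comm : ∀ n : ℤ, dom n ≫ y.h n = x.h n ≫ cod n
  comm_i : ∀ n : ℤ, cod (n + 1) ≫ cokernel.π (y.h (n + 1)) ≫ y.i n ≫ kernel.ι (y.h n) =
    cokernel.π (x.h (n + 1)) ≫ x.i n ≫ kernel.ι (x.h n) ≫ dom n

instance : Category (SeqFamily A) where
  Hom := Hom
  id x := { dom := fun _ => 𝟙 _, cod := fun _ => 𝟙 _, comm := by simp, comm_i := by simp }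
  comp {x y z} f g :=
    { dom := fun n => f.dom n ≫ g.dom n
      cod := fun n => f.cod n ≫ g.cod n
      comm := fun n => by
        rw [Category.assoc, g.comm, ← Category.assoc, f.comm, Category.assoc]
      comm_i := fun n => by
        have hf := f.comm_i n
        have hg := g.comm_i n
        rw [Category.assoc, hg]
        simp only [← Category.assoc] at hf ⊢
        rw [hf] }
  id_comp f := by apply Hom.ext <;> funext n <;> simp
  comp_id f := by apply Hom.ext <;> funext n <;> simp
  assoc f g k := by apply Hom.ext <;> funext n <;> simp

@[ext]
theorem hom_ext {x y : SeqFamily A} {f g : x ⟶ y} (h₁ : ∀ n, f.dom n = g.dom n)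
    (h₂ : ∀ n, f.cod n = g.cod n) : f = g :=
  Hom.ext (funext h₁) (funext h₂)

@[simp] theorem id_dom (x : SeqFamily A) (n : ℤ) : Hom.dom (𝟙 x) n = 𝟙 (x.dom n) := rfl
@[simp] theorem id_cod (x : SeqFamily A) (n : ℤ) : Hom.cod (𝟙 x) n = 𝟙 (x.cod n) := rfl
@[simp] theorem comp_dom {x y z : SeqFamily A} (f : x ⟶ y) (g : y ⟶ z) (n : ℤ) :
    (f ≫ g).dom n = f.dom n ≫ g.dom n := rfl
@[simp] theorem comp_cod {x y z : SeqFamily A} (f : x ⟶ y) (g : y ⟶ z) (n : ℤ) :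
    (f ≫ g).cod n = f.cod n ≫ g.cod n := rfl

/-- A sequentiable family is proper if each of its arrows `h n` is proper. -/
def IsProper (x : SeqFamily A) : Prop := ∀ n : ℤ, IsProperArrow (x.h n)

/-- The set of nullhomotopies on a morphism of sequentiable families: families of diagonals. -/
@[ext]
structure Nullhomotopy {x y : SeqFamily A} (f : x ⟶ y) where
  diag : ∀ n : ℤ, x.cod n ⟶ y.dom n
  h_diag : ∀ n : ℤ, x.h n ≫ diag n = f.dom n
  diag_h : ∀ n : ℤ, diag n ≫ y.h n = f.cod n

/-- Composition of a nullhomotopy with a morphism on the left. -/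
def Nullhomotopy.precomp {w x y : SeqFamily A} (k : w ⟶ x) {f : x ⟶ y} (μ : Nullhomotopy f) :
    Nullhomotopy (k ≫ f) where
  diag n := k.cod n ≫ μ.diag n
  h_diag n := by rw [← Category.assoc, ← k.comm, Category.assoc, μ.h_diag, comp_dom]
  diag_h n := by rw [Category.assoc, μ.diag_h, comp_cod]

variable [HasPullbacks A]

/-- The arrow `h^P` from the domain of `h n` to the pullback `P n` of `f.cod n` and `y.h n`. -/
noncomputable def thetaKernelH {x y : SeqFamily A} (f : x ⟶ y) (n : ℤ) :
    x.dom n ⟶ pullback (f.cod n) (y.h n) :=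
  pullback.lift (x.h n) (f.dom n) (f.comm n).symm

theorem thetaKernelH_fst {x y : SeqFamily A} (f : x ⟶ y) (n : ℤ) :
    thetaKernelH f n ≫ pullback.fst (f.cod n) (y.h n) = x.h n :=
  pullback.lift_fst _ _ _

theorem thetaKernelH_snd {x y : SeqFamily A} (f : x ⟶ y) (n : ℤ) :
    thetaKernelH f n ≫ pullback.snd (f.cod n) (y.h n) = f.dom n :=
  pullback.lift_snd _ _ _

/-- The homotopy kernel `N(f)` (with respect to the nullhomotopies above) of a morphism of
sequentiable families. Its connecting arrow is the unique one which is compatible with that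
of `x`. -/
noncomputable abbrev thetaKernel {x y : SeqFamily A} (f : x ⟶ y) : SeqFamily A where
  dom n := x.dom n
  cod n := pullback (f.cod n) (y.h n)
  h n := thetaKernelH f n
  i n := kernel.lift (thetaKernelH f n)
    (cokernel.desc (thetaKernelH f (n + 1))
      (pullback.fst (f.cod (n + 1)) (y.h (n + 1)) ≫ cokernel.π (x.h (n + 1)) ≫ x.i n ≫
        kernel.ι (x.h n))
      (by rw [← Category.assoc, thetaKernelH_fst, cokernel.condition_assoc, zero_comp]))
    (by
      rw [← cancel_epi (cokernel.π (thetaKernelH f (n + 1))), cokernel.π_desc_assoc, comp_zero]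
      apply pullback.hom_ext
      · simp only [Category.assoc, thetaKernelH_fst, kernel.condition, comp_zero, zero_comp]
      · simp only [Category.assoc, thetaKernelH_snd, zero_comp]
        rw [← f.comm_i n, pullback.condition_assoc, cokernel.condition_assoc, zero_comp,
          comp_zero])

/-- The projection `N(f) ⟶ x`. -/
noncomputable def thetaKernelι {x y : SeqFamily A} (f : x ⟶ y) : thetaKernel f ⟶ x where
  dom n := 𝟙 (x.dom n)
  cod n := pullback.fst (f.cod n) (y.h n)
  comm n := by
    change 𝟙 _ ≫ x.h n = thetaKernelH f n ≫ _
    rw [thetaKernelH_fst, Category.id_comp]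
  comm_i n := by
    change _ = cokernel.π (thetaKernelH f (n + 1)) ≫ kernel.lift _ _ _ ≫
      kernel.ι (thetaKernelH f n) ≫ 𝟙 _
    rw [Category.comp_id, kernel.lift_ι, cokernel.π_desc]

/-- The structural nullhomotopy of `N(f)`. -/
noncomputable def thetaKernelNull {x y : SeqFamily A} (f : x ⟶ y) :
    Nullhomotopy (thetaKernelι f ≫ f) where
  diag n := pullback.snd (f.cod n) (y.h n)
  h_diag n := by
    change thetaKernelH f n ≫ _ = 𝟙 _ ≫ f.dom n
    rw [thetaKernelH_snd, Category.id_comp]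
  diag_h n := pullback.condition.symm

/-- The universal property of the homotopy kernel. -/
theorem thetaKernel_universal {w x y : SeqFamily A} (f : x ⟶ y) (k : w ⟶ x)
    (μ : Nullhomotopy (k ≫ f)) :
    ∃! l : w ⟶ thetaKernel f, l ≫ thetaKernelι f = k ∧
      ((thetaKernelNull f).precomp l).diag = μ.diag := by
  have hμ : ∀ n, k.cod n ≫ f.cod n = μ.diag n ≫ y.h n := fun n => (μ.diag_h n).symm
  refine ⟨{ dom := k.dom
            cod := fun n => pullback.lift (k.cod n) (μ.diag n) (hμ n)
            comm := fun n => ?_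
            comm_i := fun n => ?_ }, ⟨?_, ?_⟩, ?_⟩
  · have h1 := k.comm n
    have h2 := μ.h_diag n
    rw [comp_dom] at h2
    change k.dom n ≫ thetaKernelH f n = w.h n ≫ pullback.lift (k.cod n) (μ.diag n) (hμ n)
    apply pullback.hom_ext
    · rw [Category.assoc, Category.assoc, thetaKernelH_fst, pullback.lift_fst, h1]
    · rw [Category.assoc, Category.assoc, thetaKernelH_snd, pullback.lift_snd, h2]
  · change _ ≫ cokernel.π (thetaKernelH f (n + 1)) ≫ kernel.lift _ _ _ ≫
      kernel.ι (thetaKernelH f n) = _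
    rw [kernel.lift_ι, cokernel.π_desc, pullback.lift_fst_assoc]
    exact k.comm_i n
  · refine hom_ext (fun n => ?_) (fun n => ?_)
    · exact Category.comp_id _
    · exact pullback.lift_fst _ _ _
  · funext n
    exact pullback.lift_snd _ _ _
  · rintro l ⟨h1, h2⟩
    refine hom_ext (fun n => ?_) (fun n => ?_)
    · have : l.dom n ≫ 𝟙 _ = k.dom n := congrArg (fun t => Hom.dom t n) h1
      rw [← this]
      exact (Category.comp_id _).symm
    · have e1 : l.cod n ≫ pullback.fst _ _ = k.cod n := congrArg (fun t => Hom.cod t n) h1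
      have e2 : l.cod n ≫ pullback.snd _ _ = μ.diag n := congrFun h2 n
      apply pullback.hom_ext
      · erw [pullback.lift_fst]; exact e1
      · erw [pullback.lift_snd]; exact e2

/-- If `f ≫ g` is levelwise zero, the comparison of `f` with the homotopy kernel of `g`, induced
by the zero nullhomotopy. -/
noncomputable def comparison {w x y : SeqFamily A} (f : w ⟶ x) (g : x ⟶ y)
    (h₁ : ∀ n, f.dom n ≫ g.dom n = 0) (h₂ : ∀ n, f.cod n ≫ g.cod n = 0) :
    w ⟶ thetaKernel g where
  dom n := f.dom n
  cod n := pullback.lift (f.cod n) 0 (by rw [h₂, zero_comp])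
  comm n := by
    change f.dom n ≫ thetaKernelH g n =
      w.h n ≫ pullback.lift (f.cod n) 0 (by rw [h₂, zero_comp])
    apply pullback.hom_ext
    · rw [Category.assoc, Category.assoc, thetaKernelH_fst, pullback.lift_fst, f.comm]
    · rw [Category.assoc, Category.assoc, thetaKernelH_snd, pullback.lift_snd, h₁, comp_zero]
  comm_i n := by
    change _ ≫ cokernel.π (thetaKernelH g (n + 1)) ≫ kernel.lift _ _ _ ≫
      kernel.ι (thetaKernelH g n) = _
    rw [kernel.lift_ι, cokernel.π_desc, pullback.lift_fst_assoc]
    exact f.comm_i n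

end SeqFamily

/-! ### From chain complexes to sequentiable families -/

section

variable {A : Type u} [Category.{v} A] [HasZeroMorphisms A] [HasKernels A] [HasCokernels A]

/-- The factorization `Coker d_{n+2} ⟶ Ker d_n` of `d_{n+1}`. -/
noncomputable def homologyArrow (C : ChainComplex A ℤ) (n : ℤ) :
    cokernel (C.d (n + 1 + 1) (n + 1)) ⟶ kernel (C.d n (n - 1)) :=
  cokernel.desc _ (kernel.lift _ (C.d (n + 1) n) (C.d_comp_d _ _ _))
    (by apply equalizer.hom_ext; simp)

/-- The arrow `Ker d_n ⟶ C_n ⟶ Coker d_{n+1}`. -/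
noncomputable def cyclesToCokernel (C : ChainComplex A ℤ) (n : ℤ) :
    kernel (C.d n (n - 1)) ⟶ cokernel (C.d (n + 1) n) :=
  kernel.ι _ ≫ cokernel.π _

theorem homologyArrow_comp (C : ChainComplex A ℤ) (n : ℤ) :
    homologyArrow C n ≫ cyclesToCokernel C n = 0 := by
  rw [← cancel_epi (cokernel.π _)]
  simp [homologyArrow, cyclesToCokernel]

theorem comp_homologyArrow (C : ChainComplex A ℤ) (n : ℤ) :
    cyclesToCokernel C (n + 1) ≫ homologyArrow C n = 0 := by
  rw [← cancel_mono (kernel.ι _)]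
  have : kernel.ι (C.d (n + 1) (n + 1 - 1)) ≫ C.d (n + 1) n = 0 := by
    have e : n + 1 - 1 = n := by omega
    rw [← C.d_comp_XIsoOfEq_hom e (n + 1), kernel.condition_assoc, zero_comp]
  simp [homologyArrow, cyclesToCokernel, this]

/-- The sequentiable family `F(C)` of a complex. It is indexed by its codomains: `h n` is the arrow
`Coker d_{n+2} ⟶ Ker d_n` induced by `d_{n+1}` (so that it is the arrow `h_{n+1}` of the indexing
by domains), and the connecting arrow `Coker (h (n+1)) ⟶ Ker (h n)` is induced by
`Ker d_{n+1} ⟶ C_{n+1} ⟶ Coker d_{n+2}`. -/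
noncomputable abbrev seqFamilyOf (C : ChainComplex A ℤ) : SeqFamily A where
  dom n := cokernel (C.d (n + 1 + 1) (n + 1))
  cod n := kernel (C.d n (n - 1))
  h n := homologyArrow C n
  i n := kernel.lift _ (cokernel.desc _ (cyclesToCokernel C (n + 1))
      (homologyArrow_comp C (n + 1)))
    (by rw [← cancel_epi (cokernel.π _), cokernel.π_desc_assoc, comp_homologyArrow, comp_zero])

/-- The action of `F` on morphisms of complexes. -/
noncomputable abbrev seqFamilyMap {B C : ChainComplex A ℤ} (g : B ⟶ C) :
    seqFamilyOf B ⟶ seqFamilyOf C where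
  dom n := cokernel.map _ _ (g.f (n + 1 + 1)) (g.f (n + 1)) (g.comm _ _).symm
  cod n := kernel.map _ _ (g.f n) (g.f (n - 1)) (g.comm _ _).symm
  comm n := by
    change _ ≫ homologyArrow C n = homologyArrow B n ≫ _
    rw [← cancel_epi (cokernel.π _), ← cancel_mono (kernel.ι _)]
    simp [homologyArrow]
  comm_i n := by
    change _ ≫ cokernel.π (homologyArrow C (n + 1)) ≫ kernel.lift _ _ _ ≫
      kernel.ι (homologyArrow C n) = cokernel.π (homologyArrow B (n + 1)) ≫ kernel.lift _ _ _ ≫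
      kernel.ι (homologyArrow B n) ≫ _
    rw [kernel.lift_ι, kernel.lift_ι_assoc, cokernel.π_desc, cokernel.π_desc_assoc]
    simp [cyclesToCokernel]

/-- The functor `F` from chain complexes to sequentiable families. -/
noncomputable abbrev toSeq : ChainComplex A ℤ ⥤ SeqFamily A where
  obj C := seqFamilyOf C
  map g := seqFamilyMap g
  map_id C := by
    refine SeqFamily.hom_ext (fun n => ?_) (fun n => ?_)
    · apply coequalizer.hom_ext
      exact (cokernel.π_desc _ _ _).trans
        ((Category.id_comp _).trans (Category.comp_id (cokernel.π _)).symm)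
    · apply equalizer.hom_ext
      exact (kernel.lift_ι _ _ _).trans
        ((Category.comp_id _).trans (Category.id_comp (kernel.ι _)).symm)
  map_comp {X Y Z} f g := by
    refine SeqFamily.hom_ext (fun n => ?_) (fun n => ?_)
    · have e : cokernel.map (X.d (n + 1 + 1) (n + 1)) (Z.d (n + 1 + 1) (n + 1))
          ((f ≫ g).f (n + 1 + 1)) ((f ≫ g).f (n + 1)) ((f ≫ g).comm _ _).symm =
          cokernel.map _ (Y.d (n + 1 + 1) (n + 1)) _ _ (f.comm _ _).symm ≫
            cokernel.map _ _ _ _ (g.comm _ _).symm := by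
        rw [← cancel_epi (cokernel.π _)]
        simp
      exact e
    · have e : kernel.map (X.d n (n - 1)) (Z.d n (n - 1))
          ((f ≫ g).f n) ((f ≫ g).f (n - 1)) ((f ≫ g).comm _ _).symm =
          kernel.map _ (Y.d n (n - 1)) _ _ (f.comm _ _).symm ≫
            kernel.map _ _ _ _ (g.comm _ _).symm := by
        rw [← cancel_mono (kernel.ι _)]
        simp
      exact e

/-! ### The long sequence -/

/-- The canonical isomorphism from the kernel of `d_n` to the cycles. -/
noncomputable def kernelToCycles (C : ChainComplex A ℤ) (n : ℤ) [C.HasHomology n] :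
    kernel (C.d n (n - 1)) ⟶ C.cycles n :=
  C.liftCycles (kernel.ι (C.d n (n - 1))) (n - 1) (by simp) (kernel.condition _)

/-- The canonical isomorphism from the opcycles to the cokernel of `d_{n+1}`. -/
noncomputable def opcyclesToCokernel (C : ChainComplex A ℤ) (n : ℤ) [C.HasHomology n] :
    C.opcycles n ⟶ cokernel (C.d (n + 1) n) :=
  C.descOpcycles (cokernel.π (C.d (n + 1) n)) (n + 1) (by simp) (cokernel.condition _)

theorem homologyι_comp_homologyArrow (C : ChainComplex A ℤ) (n : ℤ) [C.HasHomology (n + 1)] :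
    (C.homologyι (n + 1) ≫ opcyclesToCokernel C (n + 1)) ≫ homologyArrow C n = 0 := by
  have e : (opcyclesToCokernel C (n + 1) ≫ homologyArrow C n) ≫ kernel.ι _ =
      C.fromOpcycles (n + 1) n := by
    rw [← cancel_epi (C.pOpcycles (n + 1))]
    simp [opcyclesToCokernel, homologyArrow]
  rw [← cancel_mono (kernel.ι _), Category.assoc, Category.assoc,
    ← Category.assoc (opcyclesToCokernel _ _), e]
  simp

theorem homologyArrow_comp_homologyπ (C : ChainComplex A ℤ) (n : ℤ) [C.HasHomology n] :
    homologyArrow C n ≫ kernelToCycles C n ≫ C.homologyπ n = 0 := by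
  have e : cokernel.π _ ≫ homologyArrow C n ≫ kernelToCycles C n = C.toCycles (n + 1) n := by
    rw [← cancel_mono (C.iCycles n)]
    simp [kernelToCycles, homologyArrow]
  rw [← cancel_epi (cokernel.π _)]
  have := C.toCycles_comp_homologyπ (n + 1) n
  rw [← e] at this
  simpa using this

variable [HasPullbacks A]

/-- The cokernel, in degree `n`, of the arrow `h^P : Coker d^B_{n+2} ⟶ P` of the homotopy kernel
of `F(g)`, where `P` is the pullback of `Ker d^B_n` and `Coker d^C_{n+2}` over `Ker d^C_n`. -/
noncomputable abbrev cokerP {B C : ChainComplex A ℤ} (g : B ⟶ C) (n : ℤ) : A :=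
  cokernel ((SeqFamily.thetaKernel (toSeq.map g)).h n)

/-- The arrow `⟨0, k⟩ · q : H_{n+1}(C) ⟶ Coker h^P`, where `k` is the inclusion of the homology
into `Coker d^C_{n+2}` and `q` is the projection on the cokernel. -/
noncomputable def connecting {B C : ChainComplex A ℤ} (g : B ⟶ C) (n : ℤ)
    [C.HasHomology (n + 1)] : C.homology (n + 1) ⟶ cokerP g n :=
  pullback.lift (f := (toSeq.map g).cod n) (g := (toSeq.obj C).h n)
      0 (C.homologyι (n + 1) ≫ opcyclesToCokernel C (n + 1))
      (by rw [zero_comp]; exact (homologyι_comp_homologyArrow C n).symm) ≫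
    cokernel.π ((SeqFamily.thetaKernel (toSeq.map g)).h n)

/-- The arrow `Coker h^P ⟶ H_n(B)` induced by the projection `P ⟶ Ker d^B_n`. -/
noncomputable def toHomology {B C : ChainComplex A ℤ} (g : B ⟶ C) (n : ℤ)
    [B.HasHomology n] : cokerP g n ⟶ B.homology n :=
  cokernel.desc _
    (pullback.fst ((toSeq.map g).cod n) ((toSeq.obj C).h n) ≫ kernelToCycles B n ≫ B.homologyπ n)
    ((pullback.lift_fst_assoc _ _ _ _).trans (homologyArrow_comp_homologyπ B n))

/-- Exactness at every place of the long sequence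
`⋯ ⟶ H_{n+1}(B) ⟶ H_{n+1}(C) ⟶ Coker h^P ⟶ H_n(B) ⟶ H_n(C) ⟶ ⋯`. -/
structure IsLongExact {B C : ChainComplex A ℤ} (g : B ⟶ C) [∀ n, B.HasHomology n]
    [∀ n, C.HasHomology n] : Prop where
  exact_homology_target : ∀ n : ℤ,
    IsExactAt (HomologicalComplex.homologyMap g (n + 1)) (connecting g n)
  exact_cokernel : ∀ n : ℤ, IsExactAt (connecting g n) (toHomology g n)
  exact_homology_source : ∀ n : ℤ,
    IsExactAt (toHomology g n) (HomologicalComplex.homologyMap g n)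

/-- The comparison `F(X) ⟶ N(F(g))` for a composite `f ≫ g = 0` of morphisms of complexes. -/
noncomputable def seqComparison {X B C : ChainComplex A ℤ} (f : X ⟶ B) (g : B ⟶ C)
    (w : f ≫ g = 0) : toSeq.obj X ⟶ SeqFamily.thetaKernel (toSeq.map g) :=
  SeqFamily.comparison (toSeq.map f) (toSeq.map g)
    (fun n => by
      rw [← SeqFamily.comp_dom, ← Functor.map_comp, w]
      change (seqFamilyMap 0).dom n = 0
      apply coequalizer.hom_ext
      exact (cokernel.π_desc _ _ _).trans (zero_comp.trans comp_zero.symm))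
    (fun n => by
      rw [← SeqFamily.comp_cod, ← Functor.map_comp, w]
      change (seqFamilyMap 0).cod n = 0
      apply equalizer.hom_ext
      exact (kernel.lift_ι _ _ _).trans (comp_zero.trans zero_comp.symm))

/-- The isomorphisms `e n : H_n(X) ≅ Coker h^P` are induced by the comparison
`F(X) ⟶ N(F(g))` and turn `Coker h^P ⟶ H_n(B)` into the arrow induced by `f`. -/
def IsInducedByComparison {X B C : ChainComplex A ℤ} (f : X ⟶ B) (g : B ⟶ C) (w : f ≫ g = 0)
    [∀ n, X.HasHomology n] [∀ n, B.HasHomology n]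
    (e : ∀ n : ℤ, X.homology n ≅ cokerP g n) : Prop :=
  ∀ n : ℤ,
    kernelToCycles X n ≫ X.homologyπ n ≫ (e n).hom =
      (seqComparison f g w).cod n ≫ cokernel.π ((SeqFamily.thetaKernel (toSeq.map g)).h n) ∧
    (e n).hom ≫ toHomology g n = HomologicalComplex.homologyMap f n

/-- The defining property of the classical connecting arrow `∂ : H_{n+1}(C) ⟶ H_n(X)`, in terms of
generalized elements: if `b` lifts the class `c` to `Coker d^B_{n+2}` and the boundary of `b` is
the image of the cycle `a`, then `∂` sends `c` to the class of `a`. The second condition says that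
every class can be so lifted along a regular epimorphism, so that `∂` is unique. -/
def IsClassicalConnecting {X B C : ChainComplex A ℤ} (f : X ⟶ B) (g : B ⟶ C)
    [∀ n, X.HasHomology n] [∀ n, B.HasHomology n] [∀ n, C.HasHomology n] (n : ℤ)
    (del : C.homology (n + 1) ⟶ X.homology n) : Prop :=
  (∀ (Z : A) (c : Z ⟶ C.homology (n + 1)) (b : Z ⟶ B.opcycles (n + 1)) (a : Z ⟶ X.cycles n),
    c ≫ C.homologyι (n + 1) = b ≫ HomologicalComplex.opcyclesMap g (n + 1) →
    a ≫ HomologicalComplex.cyclesMap f n = b ≫ B.opcyclesToCycles (n + 1) n →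
    c ≫ del = a ≫ X.homologyπ n) ∧
  ∃ (Z : A) (c : Z ⟶ C.homology (n + 1)) (b : Z ⟶ B.opcycles (n + 1)) (a : Z ⟶ X.cycles n),
    IsRegularEpi c ∧
    c ≫ C.homologyι (n + 1) = b ≫ HomologicalComplex.opcyclesMap g (n + 1) ∧
    a ≫ HomologicalComplex.cyclesMap f n = b ≫ B.opcyclesToCycles (n + 1) n

end

end SnailHomology

/-! The proof is a diagram chase with generalized elements. In a regular category an arrow is a
regular epimorphism as soon as every generalized element of its target lifts after passing to a
regular epimorphic cover (`LocallyLifts`). Exactness is therefore checked on elements, and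
properness says that an element with zero class in a cokernel lifts locally along the arrow.

The only classical step that is lost is subtraction, and protomodularity replaces it. By
`exists_difference`, if `p` and `s` agree under `e` and `s` dies under `q`, then locally some
element of the kernel of `e` has the same image under `q` as `p`; it plays the role of `p - s`.
Protomodularity also makes arrows with trivial kernel monic and regular epimorphisms cokernels of
their kernels.

Elements of `P` are pairs `(z, c)` with `z` a cycle of `B`, `c` a chain of `C` modulo boundaries and
`g z = d c`; the arrow `h^P` sends `b` to `(d b, g b)`. For exactness at the cokernel, a pair whose
first entry is a boundary `d b` is corrected by `h^P b`, which leaves `(0, c)` with `c` a homology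
class of `C`. For an extension, a pair `(z, c)` with `c = g b` is corrected by the same element,
which leaves `(f a, 0)`; hence `a ↦ [(f a, 0)]` is a regular epimorphism from the homology of `X`,
and its kernel is trivial because `C` and `h^P` are proper.

The two connecting arrows are compared by one arrow `φ (g b, c) = [(d b, c)]`
(`IsExtension.exists_addition`). With `c = 0` it is the classical connecting arrow, with `b = 0` it
is `connecting`, and on the diagonal it is the class of `h^P b`, which vanishes. An abelian category
is regular and protomodular and all its arrows are proper, so the last part is a special case in
which mutually inverse means opposite. -/

namespace SnailHomology

/-! ### Generalized elements in regular protomodular categories -/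

section Regular

variable {A : Type u} [Category.{v} A]

/-- The generalized element `y` lifts along `f` after passing to a regular epimorphism. -/
def LocallyLifts {T X Y : A} (y : T ⟶ Y) (f : X ⟶ Y) : Prop :=
  ∃ (T' : A) (π : T' ⟶ T) (x : T' ⟶ X), IsRegularEpi π ∧ x ≫ f = π ≫ y

variable [Regular A]

theorem isRegularEpi_of_strongEpi {X Y : A} (f : X ⟶ Y) [StrongEpi f] : IsRegularEpi f :=
  inferInstance

theorem isRegularEpi_comp {X Y Z : A} (f : X ⟶ Y) (g : Y ⟶ Z) (hf : IsRegularEpi f)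
    (hg : IsRegularEpi g) : IsRegularEpi (f ≫ g) :=
  have := strongEpi_comp f g
  isRegularEpi_of_strongEpi _

theorem isRegularEpi_of_comp {X Y Z : A} (f : X ⟶ Y) (g : Y ⟶ Z) (h : IsRegularEpi (f ≫ g)) :
    IsRegularEpi g :=
  have := strongEpi_of_strongEpi f g
  isRegularEpi_of_strongEpi _

theorem isRegularEpi_pullback_fst {X Y Z : A} (f : X ⟶ Z) (g : Y ⟶ Z) (hg : IsRegularEpi g) :
    IsRegularEpi (pullback.fst f g) :=
  inferInstance

theorem locallyLifts_of_isRegularEpi {X Y : A} (f : X ⟶ Y) (hf : IsRegularEpi f) {T : A}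
    (y : T ⟶ Y) : LocallyLifts y f :=
  ⟨_, pullback.fst y f, pullback.snd y f, isRegularEpi_pullback_fst y f hf,
    pullback.condition.symm⟩

/-- A local lift of the identity exhibits a regular epimorphism that factors through `f` as its last
arrow. -/
theorem isRegularEpi_of_locallyLifts {X Y : A} (f : X ⟶ Y)
    (h : ∀ (T : A) (y : T ⟶ Y), LocallyLifts y f) : IsRegularEpi f := by
  obtain ⟨T', π, x, hπ, hx⟩ := h Y (𝟙 Y)
  refine isRegularEpi_of_comp x f ?_
  rw [hx, Category.comp_id]
  exact hπ

/-- Regular epimorphisms compose, so a chase may replace its element by a restriction to a cover at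
any moment. -/
theorem LocallyLifts.of_comp {T T' X Y : A} {π : T' ⟶ T} (hπ : IsRegularEpi π) {y : T ⟶ Y}
    {f : X ⟶ Y} (h : LocallyLifts (π ≫ y) f) : LocallyLifts y f := by
  obtain ⟨T'', ρ, x, hρ, hx⟩ := h
  exact ⟨T'', ρ ≫ π, x, isRegularEpi_comp _ _ hρ hπ, by rw [hx, Category.assoc]⟩

end Regular

/-! ### Exactness and properness on generalized elements -/

section Proper

variable {A : Type u} [Category.{v} A] [HasZeroMorphisms A] [Regular A]

theorem isExactAt_of_locallyLifts {X Y Z : A} (f : X ⟶ Y) (g : Y ⟶ Z) (w : f ≫ g = 0)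
    (h : ∀ (T : A) (y : T ⟶ Y), y ≫ g = 0 → LocallyLifts y f) : IsExactAt f g := by
  refine ⟨w, isRegularEpi_of_locallyLifts _ fun T y => ?_⟩
  obtain ⟨T', π, x, hπ, hx⟩ := h T (y ≫ kernel.ι g) (by simp)
  refine ⟨T', π, x, hπ, ?_⟩
  rw [← cancel_mono (kernel.ι g)]
  simpa using hx

/-- This is how properness enters a chase: an element killed by the cokernel lies in the kernel of
the cokernel, onto which `f` maps by a regular epimorphism. -/
theorem IsProperArrow.locallyLifts [HasCokernels A] {X Y : A} {f : X ⟶ Y} (hf : IsProperArrow f)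
    {T : A} (y : T ⟶ Y) (hy : y ≫ cokernel.π f = 0) : LocallyLifts y f := by
  obtain ⟨T', π, x, hπ, hx⟩ :=
    locallyLifts_of_isRegularEpi _ hf (kernel.lift (cokernel.π f) y hy)
  refine ⟨T', π, x, hπ, ?_⟩
  simpa using hx =≫ kernel.ι (cokernel.π f)

end Proper

/-! ### Consequences of protomodularity -/

section Protomodular

variable {A : Type u} [Category.{v} A] [HasZeroObject A] [HasZeroMorphisms A] [Regular A]
  [Protomodular A]

open scoped ZeroObject in
/-- The kernel and the section of a split epimorphism are jointly extremally epic. -/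
theorem isIso_of_mono_of_section_of_kernel {M W X : A} (p : W ⟶ X) (s : X ⟶ W) (hs : s ≫ p = 𝟙 X)
    (m : M ⟶ W) [Mono m] (s₀ : X ⟶ M) (hs₀ : s₀ ≫ m = s)
    (h : ∀ (T : A) (w : T ⟶ W), w ≫ p = 0 → ∃ w₀ : T ⟶ M, w₀ ≫ m = w) : IsIso m := by
  -- Pulling a point back along `0 ⟶ X` yields its kernel, so it suffices that `m` induces an
  -- isomorphism between the kernels of `m ≫ p` and `p`.
  let o : (0 : A) ⟶ X := 0
  refine Protomodular.isIso_of_isIso_pullback o (m ≫ p) s₀ p s m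
    (by rw [← Category.assoc, hs₀, hs]) hs rfl hs₀ ?_
  obtain ⟨w₀, hw₀⟩ := h _ (pullback.fst p o) (by rw [pullback.condition]; simp [o])
  refine ⟨pullback.lift w₀ (pullback.snd p o) (by rw [reassoc_of% hw₀, pullback.condition]),
    ?_, ?_⟩
  · apply pullback.hom_ext
    · rw [← cancel_mono m]
      simp [hw₀, pullback.lift_fst]
    · exact (isZero_zero A).eq_of_tgt _ _
  · apply pullback.hom_ext
    · simp [hw₀, pullback.lift_fst, pullback.lift_fst_assoc]
    · exact (isZero_zero A).eq_of_tgt _ _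

/-- An arrow that vanishes on the kernel of `f` identifies elements with the same image
under `f`. -/
theorem comp_eq_of_vanishes_on_kernel {X Y W : A} (f : X ⟶ Y) (k : X ⟶ W)
    (h : ∀ (T : A) (x : T ⟶ X), x ≫ f = 0 → x ≫ k = 0) {T : A} (x x' : T ⟶ X)
    (hx : x ≫ f = x' ≫ f) : x ≫ k = x' ≫ k := by
  let p := pullback.fst f f
  let q := pullback.snd f f
  -- The kernel pair of `f` is a point via the first projection and the diagonal. The equalizer
  -- contains the diagonal trivially, and contains the pairs `(0, y)` because then `y` is in the
  -- kernel of `f`.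
  have hi : IsIso (equalizer.ι (p ≫ k) (q ≫ k)) := by
    refine isIso_of_mono_of_section_of_kernel p (pullback.lift (𝟙 X) (𝟙 X) rfl)
      (pullback.lift_fst _ _ _) _ (equalizer.lift (pullback.lift (𝟙 X) (𝟙 X) rfl)
        (by simp [p, q, pullback.lift_fst_assoc, pullback.lift_snd_assoc]))
      (equalizer.lift_ι _ _) ?_
    intro T w hw
    refine ⟨equalizer.lift w ?_, equalizer.lift_ι _ _⟩
    have hq : (w ≫ q) ≫ f = 0 := by
      rw [Category.assoc, ← pullback.condition, reassoc_of% hw, zero_comp]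
    rw [reassoc_of% hw, zero_comp, ← Category.assoc, h _ _ hq]
  have e : p ≫ k = q ≫ k := by
    rw [← cancel_epi (equalizer.ι (p ≫ k) (q ≫ k))]
    exact equalizer.condition _ _
  have := pullback.lift x x' hx ≫= e
  simpa [p, q, pullback.lift_fst_assoc, pullback.lift_snd_assoc] using this

/-- A regular epimorphism is a cokernel of its kernel. -/
theorem exists_desc_of_isRegularEpi {X Y W : A} (f : X ⟶ Y) (hf : IsRegularEpi f) (k : X ⟶ W)
    (h : ∀ (T : A) (x : T ⟶ X), x ≫ f = 0 → x ≫ k = 0) : ∃ l : Y ⟶ W, f ≫ l = k :=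
  ⟨IsRegularEpi.desc f k (comp_eq_of_vanishes_on_kernel f k h _ _ (IsRegularEpi.w f)),
    IsRegularEpi.fac _ _ _⟩

/-- The case of the previous principle where `k` is the identity. -/
theorem mono_of_trivial_kernel {X Y : A} (f : X ⟶ Y)
    (h : ∀ (T : A) (x : T ⟶ X), x ≫ f = 0 → x = 0) : Mono f :=
  ⟨fun x x' hx => by
    simpa using comp_eq_of_vanishes_on_kernel f (𝟙 X) (fun T x hx => by simp [h T x hx]) x x' hx⟩

/-- A substitute for subtraction: if `p` and `s` have the same image under `e`, and `s` has the
image `0` under `q`, then some element of the kernel of `e` has the same image under `q` as `p`. -/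
theorem exists_difference {T W I L : A} (e : W ⟶ I) (q : W ⟶ L) (p s : T ⟶ W)
    (he : p ≫ e = s ≫ e) (hq : s ≫ q = 0) :
    ∃ (T' : A) (π : T' ⟶ T) (κ : T' ⟶ W), IsRegularEpi π ∧ κ ≫ e = 0 ∧ κ ≫ q = π ≫ p ≫ q := by
  -- The point considered is the object of pairs `(w, s)` with `e w = e s` and `q s = 0`, projected
  -- to `s` and split by the diagonal. `F` is the image under `q` of the kernel of `e`.
  let j := kernel.ι q
  let a := pullback.fst e (j ≫ e)
  let F := Regular.strongEpiMonoFactorisation (kernel.ι e ≫ q)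
  have hF : IsRegularEpi F.e := isRegularEpi_of_strongEpi _
  -- The subobject of pairs with `q w` in the image `F` contains the diagonal, where `q w = 0`, and
  -- the kernel of the projection, where `e w = 0`. Hence it is everything.
  have hi : IsIso (pullback.fst (a ≫ q) F.m) := by
    refine isIso_of_mono_of_section_of_kernel (pullback.snd e (j ≫ e))
      (pullback.lift j (𝟙 _) (by simp)) (pullback.lift_snd _ _ _) _
      (pullback.lift (pullback.lift j (𝟙 _) (by simp)) 0
        (by simp [a, j, pullback.lift_fst_assoc])) (pullback.lift_fst _ _ _) ?_
    intro T w hw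
    have hwe : (w ≫ a) ≫ e = 0 := by
      rw [Category.assoc, pullback.condition, reassoc_of% hw, zero_comp]
    refine ⟨pullback.lift w (kernel.lift e (w ≫ a) hwe ≫ F.e) ?_, pullback.lift_fst _ _ _⟩
    rw [Category.assoc, F.fac, kernel.lift_ι_assoc, Category.assoc]
  let t : T ⟶ pullback e (j ≫ e) := pullback.lift p (kernel.lift q s hq) (by simp [j, he])
  have ht : t ≫ inv (pullback.fst (a ≫ q) F.m) ≫ pullback.snd (a ≫ q) F.m ≫ F.m = p ≫ q := by
    rw [← pullback.condition]
    simp [t, a, pullback.lift_fst_assoc]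
  obtain ⟨T', π, x, hπ, hx⟩ := locallyLifts_of_isRegularEpi F.e hF
    (t ≫ inv (pullback.fst (a ≫ q) F.m) ≫ pullback.snd (a ≫ q) F.m)
  refine ⟨T', π, x ≫ kernel.ι e, hπ, by simp, ?_⟩
  have := hx =≫ F.m
  simp only [Category.assoc, ht] at this
  rw [← this, F.fac, Category.assoc]

/-- A short complex in a regular protomodular category with cokernels has homology when its first
arrow is proper. -/
theorem hasHomology_of_isProperArrow [HasCokernels A] (S : ShortComplex A)
    (hS : IsProperArrow S.f) : S.HasHomology := by
  let ρ : cokernel S.f ⟶ S.X₃ := cokernel.desc S.f S.g S.zero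
  let π : kernel S.g ⟶ kernel ρ :=
    kernel.lift ρ (kernel.ι S.g ≫ cokernel.π S.f) (by simp [ρ])
  have hπι : π ≫ kernel.ι ρ = kernel.ι S.g ≫ cokernel.π S.f := kernel.lift_ι _ _ _
  -- A preimage in `S.X₂` of an element of the kernel of `ρ` is automatically a cycle.
  have hπ : IsRegularEpi π := isRegularEpi_of_locallyLifts _ fun T y => by
    obtain ⟨T', σ, x, hσ, hx⟩ :=
      locallyLifts_of_isRegularEpi (cokernel.π S.f) inferInstance (y ≫ kernel.ι ρ)
    have hg : x ≫ S.g = 0 := by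
      have : S.g = cokernel.π S.f ≫ ρ := by simp [ρ]
      rw [this, reassoc_of% hx, kernel.condition, comp_zero, comp_zero]
    refine ⟨T', σ, kernel.lift S.g x hg, hσ, ?_⟩
    rw [← cancel_mono (kernel.ι ρ), Category.assoc, hπι, kernel.lift_ι_assoc, hx,
      Category.assoc]
  have hzero : kernel.lift S.g S.f S.zero ≫ π = 0 := by
    rw [← cancel_mono (kernel.ι ρ), Category.assoc, hπι]
    simp
  -- An element in the kernel of `π` is locally a boundary by properness of `S.f`, so any `k` that
  -- kills boundaries kills it and descends along the regular epimorphism `π`.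
  have hdesc : ∀ {Z : A} (k : kernel S.g ⟶ Z), kernel.lift S.g S.f S.zero ≫ k = 0 →
      ∃ l : kernel ρ ⟶ Z, π ≫ l = k := by
    intro Z k hk
    refine exists_desc_of_isRegularEpi π hπ k fun T x hx => ?_
    obtain ⟨T', σ, b, hσ, hb⟩ := hS.locallyLifts (x ≫ kernel.ι S.g)
      (by rw [Category.assoc, ← hπι, reassoc_of% hx, zero_comp])
    have hb' : b ≫ kernel.lift S.g S.f S.zero = σ ≫ x := by
      rw [← cancel_mono (kernel.ι S.g)]
      simpa using hb
    rw [← cancel_epi σ, ← reassoc_of% hb', hk, comp_zero, comp_zero]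
  refine ⟨⟨{
    left :=
      { K := kernel S.g
        H := kernel ρ
        i := kernel.ι S.g
        π := π
        wi := kernel.condition _
        hi := kernelIsKernel S.g
        wπ := hzero
        hπ := CokernelCofork.IsColimit.ofπ π hzero
          (fun k hk => (hdesc k hk).choose) (fun k hk => (hdesc k hk).choose_spec)
          (fun k hk l hl => by
            rw [← cancel_epi π, hl, (hdesc k hk).choose_spec]) }
    right := ShortComplex.RightHomologyData.ofHasCokernelOfHasKernel S
    iso := Iso.refl _
    comm := ?_ }⟩⟩
  exact (congrArg (π ≫ ·) (Category.id_comp _)).trans hπι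

end Protomodular

end SnailHomology

namespace SnailHomology

/-! ### Homology of complexes in terms of kernels and cokernels -/

section Kernels

variable {A : Type u} [Category.{v} A] [HasZeroMorphisms A] [HasKernels A]

/-- The arrow induced by a morphism of complexes on the kernels of the differentials. -/
noncomputable abbrev mapKernel {B C : ChainComplex A ℤ} (g : B ⟶ C) (n : ℤ) :
    kernel (B.d n (n - 1)) ⟶ kernel (C.d n (n - 1)) :=
  kernel.map _ _ (g.f n) (g.f (n - 1)) (g.comm _ _).symm

theorem mapKernel_ι {B C : ChainComplex A ℤ} (g : B ⟶ C) (n : ℤ) :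
    mapKernel g n ≫ kernel.ι _ = kernel.ι _ ≫ g.f n :=
  kernel.lift_ι _ _ _

@[simp]
theorem kernelToCycles_iCycles (C : ChainComplex A ℤ) (n : ℤ) [C.HasHomology n] :
    kernelToCycles C n ≫ C.iCycles n = kernel.ι _ := by
  simp [kernelToCycles]

end Kernels

section Cokernels

variable {A : Type u} [Category.{v} A] [HasZeroMorphisms A] [HasCokernels A]

/-- The arrow induced by a morphism of complexes on the cokernels of the differentials. -/
noncomputable abbrev mapCokernel {B C : ChainComplex A ℤ} (g : B ⟶ C) (n : ℤ) :
    cokernel (B.d (n + 1) n) ⟶ cokernel (C.d (n + 1) n) :=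
  cokernel.map _ _ (g.f (n + 1)) (g.f n) (g.comm _ _).symm

theorem π_mapCokernel {B C : ChainComplex A ℤ} (g : B ⟶ C) (n : ℤ) :
    cokernel.π _ ≫ mapCokernel g n = g.f n ≫ cokernel.π _ :=
  cokernel.π_desc _ _ _

@[simp]
theorem pOpcycles_opcyclesToCokernel (C : ChainComplex A ℤ) (n : ℤ) [C.HasHomology n] :
    C.pOpcycles n ≫ opcyclesToCokernel C n = cokernel.π _ := by
  simp [opcyclesToCokernel]

end Cokernels

section Homology

variable {A : Type u} [Category.{v} A] [HasZeroMorphisms A] [HasKernels A] [HasCokernels A]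

/-- The projection of the cycles on the homology. -/
noncomputable def cyclesClass (C : ChainComplex A ℤ) (n : ℤ) [C.HasHomology n] :
    kernel (C.d n (n - 1)) ⟶ C.homology n :=
  kernelToCycles C n ≫ C.homologyπ n

/-- The inclusion of the homology in the cokernel of the differential. -/
noncomputable def homologyInclusion (C : ChainComplex A ℤ) (n : ℤ) [C.HasHomology n] :
    C.homology n ⟶ cokernel (C.d (n + 1) n) :=
  C.homologyι n ≫ opcyclesToCokernel C n

section

variable (C : ChainComplex A ℤ) (n : ℤ)

theorem homologyArrow_ι : homologyArrow C n ≫ kernel.ι (C.d n (n - 1)) =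
    cokernel.desc (C.d (n + 1 + 1) (n + 1)) (C.d (n + 1) n) (C.d_comp_d _ _ _) := by
  rw [← cancel_epi (cokernel.π _)]
  simp [homologyArrow]

theorem π_homologyArrow_ι : cokernel.π (C.d (n + 1 + 1) (n + 1)) ≫ homologyArrow C n ≫
    kernel.ι (C.d n (n - 1)) = C.d (n + 1) n := by
  rw [homologyArrow_ι, cokernel.π_desc]

variable [C.HasHomology n]

instance isIso_kernelToCycles : IsIso (kernelToCycles C n) := by
  refine ⟨kernel.lift _ (C.iCycles n) (by simp), ?_, ?_⟩
  · rw [← cancel_mono (kernel.ι _)]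
    simp
  · rw [← cancel_mono (C.iCycles n)]
    simp

instance isIso_opcyclesToCokernel : IsIso (opcyclesToCokernel C n) := by
  refine ⟨cokernel.desc _ (C.pOpcycles n) (by simp), ?_, ?_⟩
  · rw [← cancel_epi (C.pOpcycles n)]
    simp [reassoc_of% pOpcycles_opcyclesToCokernel]
  · rw [← cancel_epi (cokernel.π _)]
    simp

instance mono_homologyInclusion : Mono (homologyInclusion C n) := by
  unfold homologyInclusion
  infer_instance

omit [HasCokernels A] in
theorem isRegularEpi_cyclesClass : IsRegularEpi (cyclesClass C n) := by
  have : IsRegularEpi (C.homologyπ n) :=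
    ⟨⟨Cofork.IsColimit.regularEpi (C.homologyIsCokernel (n + 1) n (by simp))⟩⟩
  exact (MorphismProperty.regularEpi A).cancel_left_of_respectsIso (kernelToCycles C n) _ |>.2 this

instance epi_cyclesClass : Epi (cyclesClass C n) :=
  have := isRegularEpi_cyclesClass C n
  inferInstance

theorem cyclesClass_homologyInclusion :
    cyclesClass C n ≫ homologyInclusion C n = kernel.ι _ ≫ cokernel.π _ := by
  simp [cyclesClass, homologyInclusion, reassoc_of% kernelToCycles_iCycles]

theorem homologyArrow_cyclesClass : homologyArrow C n ≫ cyclesClass C n = 0 :=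
  homologyArrow_comp_homologyπ C n

end

section

variable (C : ChainComplex A ℤ) (n : ℤ) [C.HasHomology (n + 1)]

theorem homologyInclusion_homologyArrow : homologyInclusion C (n + 1) ≫ homologyArrow C n = 0 :=
  homologyι_comp_homologyArrow C n

theorem opcyclesToCokernel_homologyArrow_ι :
    opcyclesToCokernel C (n + 1) ≫ homologyArrow C n ≫ kernel.ι _ = C.fromOpcycles (n + 1) n := by
  rw [← cancel_epi (C.pOpcycles (n + 1)), reassoc_of% pOpcycles_opcyclesToCokernel, π_homologyArrow_ι]
  simp

theorem opcyclesToCokernel_homologyArrow_kernelToCycles [C.HasHomology n] :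
    opcyclesToCokernel C (n + 1) ≫ homologyArrow C n ≫ kernelToCycles C n =
      C.opcyclesToCycles (n + 1) n := by
  rw [← cancel_mono (C.iCycles n), Category.assoc, Category.assoc, kernelToCycles_iCycles,
    opcyclesToCokernel_homologyArrow_ι, HomologicalComplex.opcyclesToCycles_iCycles]

/-- The homology is the kernel of `fromOpcycles`, which is `homologyArrow` up to the identification
of the opcycles with the cokernel and the inclusion of the cycles. -/
theorem exists_comp_homologyInclusion {T : A} (x : T ⟶ cokernel (C.d (n + 1 + 1) (n + 1)))
    (hx : x ≫ homologyArrow C n = 0) :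
    ∃ c : T ⟶ C.homology (n + 1), c ≫ homologyInclusion C (n + 1) = x := by
  have h : (x ≫ inv (opcyclesToCokernel C (n + 1))) ≫ C.fromOpcycles (n + 1) n = 0 := by
    rw [← opcyclesToCokernel_homologyArrow_ι, Category.assoc, IsIso.inv_hom_id_assoc,
      reassoc_of% hx, zero_comp]
  obtain ⟨c, hc⟩ := KernelFork.IsLimit.lift'
    (C.homologyIsKernel (n + 1) n (by simp)) _ h
  refine ⟨c, ?_⟩
  change c ≫ C.homologyι (n + 1) = _ at hc
  rw [homologyInclusion, reassoc_of% hc, IsIso.inv_hom_id, Category.comp_id]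

end

section

variable {B C : ChainComplex A ℤ} (g : B ⟶ C) (n : ℤ)

theorem homologyArrow_mapKernel :
    homologyArrow B n ≫ mapKernel g n = mapCokernel g (n + 1) ≫ homologyArrow C n := by
  rw [← cancel_mono (kernel.ι _), ← cancel_epi (cokernel.π _)]
  simp only [Category.assoc]
  rw [mapKernel_ι, reassoc_of% π_homologyArrow_ι, reassoc_of% π_mapCokernel, π_homologyArrow_ι]
  exact (g.comm _ _).symm

variable [B.HasHomology n] [C.HasHomology n]

omit [HasCokernels A] in
theorem kernelToCycles_cyclesMap : kernelToCycles B n ≫ HomologicalComplex.cyclesMap g n =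
    mapKernel g n ≫ kernelToCycles C n := by
  rw [← cancel_mono (C.iCycles n)]
  simp [reassoc_of% kernelToCycles_iCycles]

omit [HasKernels A] in
theorem opcyclesMap_opcyclesToCokernel :
    HomologicalComplex.opcyclesMap g n ≫ opcyclesToCokernel C n =
      opcyclesToCokernel B n ≫ mapCokernel g n := by
  rw [← cancel_epi (B.pOpcycles n)]
  simp [reassoc_of% pOpcycles_opcyclesToCokernel]

omit [HasCokernels A] in
theorem cyclesClass_homologyMap : cyclesClass B n ≫ HomologicalComplex.homologyMap g n =
    mapKernel g n ≫ cyclesClass C n := by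
  rw [cyclesClass, cyclesClass, Category.assoc, HomologicalComplex.homologyπ_naturality,
    reassoc_of% kernelToCycles_cyclesMap]

omit [HasKernels A] in
theorem homologyMap_homologyInclusion : HomologicalComplex.homologyMap g n ≫
    homologyInclusion C n = homologyInclusion B n ≫ mapCokernel g n := by
  rw [homologyInclusion, homologyInclusion, HomologicalComplex.homologyι_naturality_assoc,
    opcyclesMap_opcyclesToCokernel, Category.assoc]

end

end Homology

/-! ### The cokernel of the homotopy kernel -/

section CokerP

variable {A : Type u} [Category.{v} A] [HasZeroMorphisms A] [HasKernels A] [HasCokernels A]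
  [HasPullbacks A] {B C : ChainComplex A ℤ} (g : B ⟶ C) (n : ℤ)

/-- The pullback of `Ker d^B_n` and `Coker d^C_{n+2}` over `Ker d^C_n`. -/
noncomputable abbrev pullbackP : A := pullback (mapKernel g n) (homologyArrow C n)

/-- The arrow `h^P : Coker d^B_{n+2} ⟶ P`. -/
noncomputable abbrev arrowP : cokernel (B.d (n + 1 + 1) (n + 1)) ⟶ pullbackP g n :=
  pullback.lift (homologyArrow B n) (mapCokernel g (n + 1)) (homologyArrow_mapKernel g n)

/-- The projection `P ⟶ Coker h^P`. -/
noncomputable def projP : pullbackP g n ⟶ cokerP g n := cokernel.π (arrowP g n)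

theorem arrowP_projP : arrowP g n ≫ projP g n = 0 := cokernel.condition (arrowP g n)

instance epi_projP : Epi (projP g n) := inferInstanceAs (Epi (cokernel.π (arrowP g n)))

theorem isRegularEpi_projP : IsRegularEpi (projP g n) :=
  inferInstanceAs (IsRegularEpi (cokernel.π (arrowP g n)))

theorem projP_toHomology [B.HasHomology n] :
    projP g n ≫ toHomology g n = pullback.fst _ _ ≫ cyclesClass B n :=
  cokernel.π_desc _ _ _

theorem comp_connecting [C.HasHomology (n + 1)] {T : A} (c : T ⟶ C.homology (n + 1))
    (w : 0 ≫ mapKernel g n = (c ≫ homologyInclusion C (n + 1)) ≫ homologyArrow C n) :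
    c ≫ connecting g n =
      pullback.lift (0 : T ⟶ _) (c ≫ homologyInclusion C (n + 1)) w ≫ projP g n := by
  refine (Category.assoc _ _ _).symm.trans (congrArg (· ≫ projP g n) ?_)
  apply pullback.hom_ext
  · exact (Category.assoc _ _ _).trans (((congrArg (c ≫ ·) (pullback.lift_fst _ _ _)).trans
      comp_zero).trans (pullback.lift_fst _ _ _).symm)
  · exact (Category.assoc _ _ _).trans ((congrArg (c ≫ ·) (pullback.lift_snd _ _ _)).trans
      (pullback.lift_snd _ _ _).symm)

end CokerP

end SnailHomology

namespace SnailHomology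

/-! ### Exactness of the long sequence -/

section

variable {A : Type u} [Category.{v} A] [HasZeroMorphisms A] [HasCokernels A] [Regular A]

theorem IsProperComplex.exists_boundary {C : ChainComplex A ℤ} (hC : IsProperComplex C) {n : ℤ}
    {T : A} (c : T ⟶ C.X n) (hc : c ≫ cokernel.π (C.d (n + 1) n) = 0) :
    LocallyLifts c (C.d (n + 1) n) :=
  (hC n).locallyLifts c hc

/-- A cycle of zero homology class has zero image in the cokernel of the differential, so by
properness it is locally a boundary. -/
theorem IsProperComplex.locallyLifts_homologyArrow {C : ChainComplex A ℤ}
    (hC : IsProperComplex C) {n : ℤ} [C.HasHomology n] {T : A}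
    (z : T ⟶ kernel (C.d n (n - 1))) (hz : z ≫ cyclesClass C n = 0) :
    LocallyLifts z (homologyArrow C n) := by
  obtain ⟨T', π, b, hπ, hb⟩ := hC.exists_boundary (z ≫ kernel.ι _)
    (by rw [Category.assoc, ← cyclesClass_homologyInclusion, reassoc_of% hz, zero_comp])
  refine ⟨T', π, b ≫ cokernel.π _, hπ, ?_⟩
  rw [← cancel_mono (kernel.ι _), Category.assoc, Category.assoc, π_homologyArrow_ι, hb,
    Category.assoc]

theorem locallyLifts_arrowP {B C : ChainComplex A ℤ} {g : B ⟶ C}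
    (hP : (SeqFamily.thetaKernel (toSeq.map g)).IsProper) {n : ℤ} {T : A}
    (p : T ⟶ pullbackP g n) (hp : p ≫ projP g n = 0) : LocallyLifts p (arrowP g n) :=
  (hP n).locallyLifts p hp

variable [HasZeroObject A] [Protomodular A]

theorem IsProperComplex.hasHomology {C : ChainComplex A ℤ} (hC : IsProperComplex C) (n : ℤ) :
    C.HasHomology n :=
  have : (C.sc' (n + 1) n (n - 1)).HasHomology := hasHomology_of_isProperArrow _ (hC n)
  ShortComplex.hasHomology_of_iso (C.isoSc' (n + 1) n (n - 1) (by simp) (by simp)).symm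

/-- The long exact homology sequence of a morphism of proper complexes. -/
theorem isLongExact_of_isProper {B C : ChainComplex A ℤ} (g : B ⟶ C) [∀ n, B.HasHomology n]
    [∀ n, C.HasHomology n] (hB : IsProperComplex B) (hC : IsProperComplex C)
    (hP : (SeqFamily.thetaKernel (toSeq.map g)).IsProper) : IsLongExact g where
  exact_homology_target n := by
    refine isExactAt_of_locallyLifts _ _ ?_ fun T c hc => ?_
    · rw [comp_connecting g n _ (by
        rw [Category.assoc, homologyInclusion_homologyArrow, comp_zero, zero_comp])]
      -- For a class `b` of `B` one has `(0, g b) = (d b, g b)`, which is in the image of `h^P`.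
      refine Eq.trans ?_ ((homologyInclusion B (n + 1) ≫= arrowP_projP g n).trans comp_zero)
      rw [← Category.assoc (homologyInclusion B (n + 1))]
      congr 1
      apply pullback.hom_ext
      · simp only [Category.assoc, pullback.lift_fst, homologyInclusion_homologyArrow]
      · simp only [Category.assoc, pullback.lift_snd, homologyMap_homologyInclusion]
    · rw [comp_connecting g n _ (by
        rw [Category.assoc, homologyInclusion_homologyArrow, comp_zero, zero_comp])] at hc
      -- Locally `(0, c) = (d x, g x)`; the first entry makes `x` a homology class of `B` and the
      -- second says that it maps to `c`.
      obtain ⟨T', π, x, hπ, hx⟩ := locallyLifts_arrowP hP _ hc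
      have h₁ := hx =≫ pullback.fst _ _
      have h₂ := hx =≫ pullback.snd _ _
      simp only [Category.assoc, pullback.lift_fst, pullback.lift_snd, comp_zero] at h₁ h₂
      obtain ⟨b, rfl⟩ := exists_comp_homologyInclusion B n x h₁
      refine ⟨T', π, b, hπ, ?_⟩
      rw [← cancel_mono (homologyInclusion C (n + 1)), Category.assoc, Category.assoc,
        homologyMap_homologyInclusion, ← h₂, Category.assoc]
  exact_cokernel n := by
    refine isExactAt_of_locallyLifts _ _ ?_ fun T w hw => ?_
    · rw [← Category.id_comp (connecting g n), comp_connecting g n _ (by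
        rw [Category.assoc, homologyInclusion_homologyArrow, comp_zero, zero_comp]),
        Category.assoc, projP_toHomology, pullback.lift_fst_assoc, zero_comp]
    · obtain ⟨T₁, π₁, p, hπ₁, hp⟩ := locallyLifts_of_isRegularEpi _ (isRegularEpi_projP g n) w
      refine LocallyLifts.of_comp hπ₁ ?_
      obtain ⟨T₂, π₂, x, hπ₂, hx⟩ := hB.locallyLifts_homologyArrow (p ≫ pullback.fst _ _)
        (by rw [Category.assoc, ← projP_toHomology, reassoc_of% hp, hw, comp_zero])
      refine LocallyLifts.of_comp hπ₂ ?_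
      -- `κ` stands for `p - h^P x`: its first entry is zero and its class is still that of `p`.
      obtain ⟨T₃, π₃, κ, hπ₃, hκ₁, hκ₂⟩ := exists_difference (pullback.fst _ _) (projP g n)
        (π₂ ≫ p) (x ≫ arrowP g n)
        (by simp only [Category.assoc, pullback.lift_fst]; exact hx.symm)
        (by rw [Category.assoc, arrowP_projP, comp_zero])
      obtain ⟨c, hc⟩ := exists_comp_homologyInclusion C n (κ ≫ pullback.snd _ _)
        (by rw [Category.assoc, ← pullback.condition, reassoc_of% hκ₁, zero_comp])
      refine ⟨T₃, π₃, c, hπ₃, ?_⟩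
      rw [comp_connecting g n c (by
        rw [Category.assoc, homologyInclusion_homologyArrow, comp_zero, zero_comp]),
        ← hp, ← Category.assoc π₂, ← hκ₂]
      congr 1
      apply pullback.hom_ext
      · rw [pullback.lift_fst, hκ₁]
      · rw [pullback.lift_snd, hc]
  exact_homology_source n := by
    refine isExactAt_of_locallyLifts _ _ ?_ fun T z hz => ?_
    · rw [← cancel_epi (projP g n), ← Category.assoc, projP_toHomology, Category.assoc,
        cyclesClass_homologyMap, pullback.condition_assoc, homologyArrow_cyclesClass, comp_zero,
        comp_zero]
    · obtain ⟨T₁, π₁, y, hπ₁, hy⟩ :=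
        locallyLifts_of_isRegularEpi _ (isRegularEpi_cyclesClass B n) z
      refine LocallyLifts.of_comp hπ₁ ?_
      obtain ⟨T₂, π₂, x, hπ₂, hx⟩ := hC.locallyLifts_homologyArrow (y ≫ mapKernel g n)
        (by rw [Category.assoc, ← cyclesClass_homologyMap, reassoc_of% hy, hz, comp_zero])
      -- Since `g y = d x` locally, the pair `(y, x)` is an element of `P` over the class of `y`.
      refine ⟨T₂, π₂, pullback.lift (π₂ ≫ y) x (by rw [Category.assoc, hx]) ≫ projP g n, hπ₂, ?_⟩
      rw [Category.assoc, projP_toHomology, pullback.lift_fst_assoc, Category.assoc, hy]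

end

/-! ### Extensions -/

section Extension

variable {A : Type u} [Category.{v} A] [HasZeroMorphisms A] {X B C : ChainComplex A ℤ}
  {f : X ⟶ B} {g : B ⟶ C}

theorem IsExtension.mono (h : IsExtension f g) (n : ℤ) : Mono (f.f n) := by
  obtain ⟨w, ⟨hl⟩, -⟩ := h n
  exact mono_of_isLimit_fork hl

theorem IsExtension.exists_lift (h : IsExtension f g) {n : ℤ} {T : A} (b : T ⟶ B.X n)
    (hb : b ≫ g.f n = 0) : ∃ x : T ⟶ X.X n, x ≫ f.f n = b := by
  obtain ⟨w, ⟨hl⟩, -⟩ := h n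
  obtain ⟨x, hx⟩ := KernelFork.IsLimit.lift' hl b hb
  exact ⟨x, hx⟩

theorem IsExtension.isRegularEpi (h : IsExtension f g) (n : ℤ) : IsRegularEpi (g.f n) := by
  obtain ⟨w, -, ⟨hc⟩⟩ := h n
  exact ⟨⟨Cofork.IsColimit.regularEpi hc⟩⟩

theorem IsExtension.exists_lift_kernel [HasKernels A] (h : IsExtension f g) {n : ℤ} {T : A}
    (z : T ⟶ kernel (B.d n (n - 1))) (hz : z ≫ mapKernel g n = 0) :
    ∃ a : T ⟶ kernel (X.d n (n - 1)), a ≫ mapKernel f n = z := by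
  obtain ⟨x, hx⟩ := h.exists_lift (z ≫ kernel.ι _)
    (by rw [Category.assoc, ← mapKernel_ι, reassoc_of% hz, zero_comp])
  have := h.mono (n - 1)
  refine ⟨kernel.lift _ x ?_, ?_⟩
  · rw [← cancel_mono (f.f (n - 1)), Category.assoc, ← f.comm, reassoc_of% hx, kernel.condition,
      comp_zero, zero_comp]
  · rw [← cancel_mono (kernel.ι _), Category.assoc, mapKernel_ι, kernel.lift_ι_assoc, hx]

theorem mapKernel_comp_mapKernel [HasKernels A] (w : f ≫ g = 0) (n : ℤ) :
    mapKernel f n ≫ mapKernel g n = 0 := by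
  rw [← cancel_mono (kernel.ι _), Category.assoc, mapKernel_ι, ← Category.assoc, mapKernel_ι,
    Category.assoc, ← HomologicalComplex.comp_f, w]
  simp

theorem mapCokernel_comp_mapCokernel [HasCokernels A] (w : f ≫ g = 0) (n : ℤ) :
    mapCokernel f n ≫ mapCokernel g n = 0 := by
  rw [← cancel_epi (cokernel.π _), ← Category.assoc, π_mapCokernel, Category.assoc, π_mapCokernel,
    ← Category.assoc, ← HomologicalComplex.comp_f, w]
  simp

variable [HasCokernels A] [Regular A]

theorem IsExtension.isRegularEpi_mapCokernel (h : IsExtension f g) (n : ℤ) :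
    IsRegularEpi (mapCokernel g n) := by
  refine isRegularEpi_of_comp (cokernel.π _) _ ?_
  rw [π_mapCokernel]
  exact isRegularEpi_comp _ _ (h.isRegularEpi n) inferInstance

/-- The arrow `Ker d^X_n ⟶ P` of the comparison with the homotopy kernel. -/
noncomputable abbrev kernelToP (w : f ≫ g = 0) (n : ℤ) :
    kernel (X.d n (n - 1)) ⟶ pullbackP g n :=
  pullback.lift (mapKernel f n) 0 (by rw [mapKernel_comp_mapKernel w, zero_comp])

theorem homologyArrow_kernelToP (w : f ≫ g = 0) (n : ℤ) :
    homologyArrow X n ≫ kernelToP w n = mapCokernel f (n + 1) ≫ arrowP g n := by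
  apply pullback.hom_ext
  · simp only [Category.assoc, pullback.lift_fst, homologyArrow_mapKernel]
  · simp only [Category.assoc, pullback.lift_snd, mapCokernel_comp_mapCokernel w, comp_zero]

variable [HasZeroObject A] [Protomodular A]

/-- If `(f a, 0) = h^P b`, then `f a = d b` and `g b` is a boundary, which lifts to a boundary `d s`
of `B`. The difference `b - d s` is in the kernel of `g`, hence comes from some `x` in `X`, and `d x
= a`. -/
theorem IsExtension.vanishes_of_kernelToP_projP (h : IsExtension f g) (w : f ≫ g = 0)
    (hC : IsProperComplex C)
    (hP : (SeqFamily.thetaKernel (toSeq.map g)).IsProper) (n : ℤ) [X.HasHomology n] {T : A}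
    (a : T ⟶ kernel (X.d n (n - 1))) (ha : a ≫ kernelToP w n ≫ projP g n = 0) :
    a ≫ cyclesClass X n = 0 := by
  obtain ⟨T₁, π₁, b, hπ₁, hb⟩ := locallyLifts_arrowP hP (a ≫ kernelToP w n)
    (by rw [Category.assoc, ha])
  obtain ⟨T₂, π₂, b', hπ₂, hb'⟩ :=
    locallyLifts_of_isRegularEpi (cokernel.π (B.d (n + 1 + 1) (n + 1))) inferInstance b
  have h₁ : b' ≫ B.d (n + 1) n = π₂ ≫ π₁ ≫ a ≫ kernel.ι _ ≫ f.f n := by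
    have := hb =≫ (pullback.fst _ _ ≫ kernel.ι _)
    simp only [Category.assoc, pullback.lift_fst_assoc, mapKernel_ι] at this
    rw [← this, ← reassoc_of% hb', π_homologyArrow_ι]
  have h₂ : (b' ≫ g.f (n + 1)) ≫ cokernel.π (C.d (n + 1 + 1) (n + 1)) = 0 := by
    have := hb =≫ pullback.snd _ _
    simp only [Category.assoc, pullback.lift_snd, comp_zero] at this
    rw [Category.assoc, ← π_mapCokernel, reassoc_of% hb', this, comp_zero]
  obtain ⟨T₃, π₃, c, hπ₃, hc⟩ := hC.exists_boundary _ h₂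
  obtain ⟨T₄, π₄, s, hπ₄, hs⟩ := locallyLifts_of_isRegularEpi _ (h.isRegularEpi (n + 1 + 1)) c
  -- `κ` stands for `b' - d s`: both terms have the same image under `g`, and `d s` has zero
  -- boundary.
  obtain ⟨T₅, π₅, κ, hπ₅, hκ₁, hκ₂⟩ := exists_difference (g.f (n + 1)) (B.d (n + 1) n)
    (π₄ ≫ π₃ ≫ b') (s ≫ B.d (n + 1 + 1) (n + 1))
    (by rw [Category.assoc, Category.assoc, Category.assoc, ← g.comm, reassoc_of% hs, hc])
    (by simp)
  obtain ⟨x, rfl⟩ := h.exists_lift κ hκ₁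
  have hx : (x ≫ cokernel.π _) ≫ homologyArrow X n = π₅ ≫ π₄ ≫ π₃ ≫ π₂ ≫ π₁ ≫ a := by
    have := h.mono n
    rw [← cancel_mono (kernel.ι _), ← cancel_mono (f.f n)]
    simp only [Category.assoc]
    rw [reassoc_of% π_homologyArrow_ι, ← f.comm, ← Category.assoc x, hκ₂]
    simp only [Category.assoc, h₁]
  rw [← cancel_epi π₁, ← cancel_epi π₂, ← cancel_epi π₃, ← cancel_epi π₄, ← cancel_epi π₅]
  simp only [comp_zero]
  have := hx =≫ cyclesClass X n
  simp only [Category.assoc, homologyArrow_cyclesClass, comp_zero] at this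
  exact this.symm

/-- The homology of the kernel of an extension is the cokernel of `h^P`. -/
theorem IsExtension.exists_iso_cokerP (h : IsExtension f g) (w : f ≫ g = 0)
    (hC : IsProperComplex C)
    (hP : (SeqFamily.thetaKernel (toSeq.map g)).IsProper) (n : ℤ) [X.HasHomology n] :
    ∃ e : X.homology n ≅ cokerP g n, cyclesClass X n ≫ e.hom = kernelToP w n ≫ projP g n := by
  have hX := isRegularEpi_cyclesClass X n
  have hd : ∃ η : X.homology n ⟶ cokerP g n,
      cyclesClass X n ≫ η = kernelToP w n ≫ projP g n := by
    have h₀ : homologyArrow X n ≫ kernelToP w n ≫ projP g n = 0 := by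
      rw [← Category.assoc, homologyArrow_kernelToP, Category.assoc, arrowP_projP, comp_zero]
    have h₁ : X.toCycles (n + 1) n ≫ inv (kernelToCycles X n) =
        cokernel.π _ ≫ homologyArrow X n := by
      rw [← cancel_mono (kernelToCycles X n), ← cancel_mono (X.iCycles n)]
      simp [π_homologyArrow_ι]
    obtain ⟨η, hη⟩ := CokernelCofork.IsColimit.desc' (X.homologyIsCokernel (n + 1) n (by simp))
      (inv (kernelToCycles X n) ≫ kernelToP w n ≫ projP g n)
      (by rw [reassoc_of% h₁, h₀, comp_zero])
    change X.homologyπ n ≫ η = _ at hη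
    exact ⟨η, by rw [cyclesClass, Category.assoc, hη, IsIso.hom_inv_id_assoc]⟩
  obtain ⟨η, hη⟩ := hd
  have hm : Mono η := mono_of_trivial_kernel η fun T ξ hξ => by
    obtain ⟨T', π, a, hπ, ha⟩ := locallyLifts_of_isRegularEpi _ hX ξ
    rw [← cancel_epi π, comp_zero, ← ha]
    exact h.vanishes_of_kernelToP_projP w hC hP n a
      (by rw [← hη, reassoc_of% ha, hξ, comp_zero])
  have he : IsRegularEpi η := isRegularEpi_of_locallyLifts η fun T y => by
    obtain ⟨T₁, π₁, p, hπ₁, hp⟩ := locallyLifts_of_isRegularEpi _ (isRegularEpi_projP g n) y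
    refine LocallyLifts.of_comp hπ₁ ?_
    obtain ⟨T₂, π₂, b, hπ₂, hb⟩ := locallyLifts_of_isRegularEpi _
      (h.isRegularEpi_mapCokernel (n + 1)) (p ≫ pullback.snd _ _)
    refine LocallyLifts.of_comp hπ₂ ?_
    -- `κ` stands for `p - h^P b`: its second entry is zero, so its first entry is a cycle in the
    -- kernel of `g` and comes from `X`.
    obtain ⟨T₃, π₃, κ, hπ₃, hκ₁, hκ₂⟩ := exists_difference (pullback.snd _ _) (projP g n)
      (π₂ ≫ p) (b ≫ arrowP g n)
      (by simp only [Category.assoc, pullback.lift_snd]; exact hb.symm)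
      (by rw [Category.assoc, arrowP_projP, comp_zero])
    obtain ⟨a, ha⟩ := h.exists_lift_kernel (κ ≫ pullback.fst _ _)
      (by rw [Category.assoc, pullback.condition, reassoc_of% hκ₁, zero_comp])
    refine ⟨T₃, π₃, a ≫ cyclesClass X n, hπ₃, ?_⟩
    rw [Category.assoc, hη, ← hp, ← Category.assoc π₂, ← hκ₂, ← Category.assoc]
    congr 1
    apply pullback.hom_ext
    · rw [Category.assoc, pullback.lift_fst, ha]
    · rw [Category.assoc, pullback.lift_snd, hκ₁, comp_zero]
  have : IsIso η := isIso_of_mono_of_strongEpi η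
  exact ⟨asIso η, hη⟩

/-- The arrow `H_{n+1}(C) × H_{n+1}(C) ⟶ Coker h^P` sending `(g b, c)` to the class of
`(d b, c)`. -/
theorem IsExtension.exists_addition (h : IsExtension f g) (n : ℤ) [C.HasHomology (n + 1)] :
    ∃ φ : C.homology (n + 1) ⨯ C.homology (n + 1) ⟶ cokerP g n,
      ∀ (T : A) (c c' : T ⟶ C.homology (n + 1)) (b : T ⟶ cokernel (B.d (n + 1 + 1) (n + 1)))
        (_ : b ≫ mapCokernel g (n + 1) = c ≫ homologyInclusion C (n + 1))
        (w : (b ≫ homologyArrow B n) ≫ mapKernel g n =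
          (c' ≫ homologyInclusion C (n + 1)) ≫ homologyArrow C n),
        prod.lift c c' ≫ φ = pullback.lift _ _ w ≫ projP g n := by
  let k := homologyInclusion C (n + 1)
  let V := pullback (prod.fst ≫ k : C.homology (n + 1) ⨯ C.homology (n + 1) ⟶ _)
    (mapCokernel g (n + 1))
  let ρ : V ⟶ C.homology (n + 1) ⨯ C.homology (n + 1) := pullback.fst _ _
  let β : V ⟶ cokernel (B.d (n + 1 + 1) (n + 1)) := pullback.snd _ _
  have hρ : IsRegularEpi ρ := isRegularEpi_pullback_fst _ _ (h.isRegularEpi_mapCokernel (n + 1))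
  have hρβ : β ≫ mapCokernel g (n + 1) = ρ ≫ prod.fst ≫ k := pullback.condition.symm
  have hw : (β ≫ homologyArrow B n) ≫ mapKernel g n =
      (ρ ≫ prod.snd ≫ k) ≫ homologyArrow C n := by
    rw [Category.assoc, homologyArrow_mapKernel, reassoc_of% hρβ, Category.assoc, Category.assoc]
    simp only [k, homologyInclusion_homologyArrow, comp_zero]
  let ψ : V ⟶ pullbackP g n := pullback.lift _ _ hw
  -- `V` consists of triples `(c, c', b)` with `b` over `c`. The class of `(d b, c')` does not
  -- depend on `b`: on the kernel of `ρ` one has `c' = 0` and `g b = 0`, so `(d b, c') = h^P b`.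
  obtain ⟨φ, hφ⟩ := exists_desc_of_isRegularEpi ρ hρ (ψ ≫ projP g n) fun T t ht => by
    have : t ≫ ψ = (t ≫ β) ≫ arrowP g n := by
      apply pullback.hom_ext
      · simp only [ψ, Category.assoc, pullback.lift_fst]
      · simp only [ψ, Category.assoc, pullback.lift_snd, hρβ, reassoc_of% ht, zero_comp]
    rw [reassoc_of% this, arrowP_projP, comp_zero, comp_zero]
  refine ⟨φ, fun T c c' b hb w => ?_⟩
  let t : T ⟶ V := pullback.lift (prod.lift c c') b (by rw [hb, prod.lift_fst_assoc])
  have ht : t ≫ ρ = prod.lift c c' := pullback.lift_fst _ _ _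
  have ht' : t ≫ β = b := pullback.lift_snd _ _ _
  rw [← ht, Category.assoc, hφ, ← Category.assoc]
  congr 1
  apply pullback.hom_ext
  · simp only [ψ, Category.assoc, pullback.lift_fst, reassoc_of% ht']
  · simp only [ψ, Category.assoc, pullback.lift_snd, reassoc_of% ht, prod.lift_snd_assoc, k]

end Extension

end SnailHomology

namespace SnailHomology

/-! ### The induced isomorphisms and the classical connecting arrow -/

section

variable {A : Type u} [Category.{v} A] [HasZeroMorphisms A] [HasCokernels A] [Regular A]
  {X B C : ChainComplex A ℤ} {f : X ⟶ B} {g : B ⟶ C}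

theorem isInducedByComparison_of_cyclesClass (w : f ≫ g = 0) [∀ n, X.HasHomology n]
    [∀ n, B.HasHomology n] (e : ∀ n : ℤ, X.homology n ≅ cokerP g n)
    (he : ∀ n, cyclesClass X n ≫ (e n).hom = kernelToP w n ≫ projP g n) :
    IsInducedByComparison f g w e := by
  refine fun n => ⟨?_, ?_⟩
  · rw [← Category.assoc]
    exact he n
  · rw [← cancel_epi (cyclesClass X n), reassoc_of% he, projP_toHomology,
      cyclesClass_homologyMap, pullback.lift_fst_assoc]

variable [HasZeroObject A] [Protomodular A]

/-- The connecting arrow of an extension exists, and it is opposite to the connecting arrow of the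
long sequence of the homotopy kernel. -/
theorem IsExtension.exists_isClassicalConnecting (h : IsExtension f g) (w : f ≫ g = 0)
    [∀ n, X.HasHomology n] [∀ n, B.HasHomology n] [∀ n, C.HasHomology n] (n : ℤ)
    (e : X.homology n ≅ cokerP g n)
    (he : cyclesClass X n ≫ e.hom = kernelToP w n ≫ projP g n) :
    ∃ del : C.homology (n + 1) ⟶ X.homology n, IsClassicalConnecting f g n del ∧
      AreMutuallyInverse (del ≫ e.hom) (connecting g n) := by
  obtain ⟨φ, hφ⟩ := h.exists_addition n
  let c₀ := pullback.fst (homologyInclusion C (n + 1)) (mapCokernel g (n + 1))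
  let b₀ := pullback.snd (homologyInclusion C (n + 1)) (mapCokernel g (n + 1))
  have hc₀ : IsRegularEpi c₀ :=
    isRegularEpi_pullback_fst _ _ (h.isRegularEpi_mapCokernel (n + 1))
  have hb₀ : b₀ ≫ mapCokernel g (n + 1) = c₀ ≫ homologyInclusion C (n + 1) :=
    pullback.condition.symm
  have hb₀' : (b₀ ≫ homologyArrow B n) ≫ mapKernel g n = 0 := by
    rw [Category.assoc, homologyArrow_mapKernel, reassoc_of% hb₀,
      homologyInclusion_homologyArrow, comp_zero]
  -- The classical arrow is `φ` restricted to the first factor, since `φ (g b, 0) = [(d b, 0)] = [(f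
  -- a, 0)]`, carried back along `e`.
  refine ⟨prod.lift (𝟙 _) 0 ≫ φ ≫ e.inv, ⟨fun Z c b a hc ha => ?_, ?_⟩, φ, ?_, ?_, ?_⟩
  · have hb : (b ≫ opcyclesToCokernel B (n + 1)) ≫ mapCokernel g (n + 1) =
        c ≫ homologyInclusion C (n + 1) := by
      rw [homologyInclusion, reassoc_of% hc, opcyclesMap_opcyclesToCokernel, Category.assoc]
    have ha' : (a ≫ inv (kernelToCycles X n)) ≫ mapKernel f n =
        (b ≫ opcyclesToCokernel B (n + 1)) ≫ homologyArrow B n := by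
      rw [← cancel_mono (kernelToCycles B n)]
      simp only [Category.assoc]
      rw [← kernelToCycles_cyclesMap, IsIso.inv_hom_id_assoc, ha,
        opcyclesToCokernel_homologyArrow_kernelToCycles]
    have ha'' : a ≫ X.homologyπ n = (a ≫ inv (kernelToCycles X n)) ≫ cyclesClass X n := by
      simp [cyclesClass]
    rw [← cancel_mono e.hom, ha'', Category.assoc _ (cyclesClass X n), he, Category.assoc, Category.assoc,
      Category.assoc, e.inv_hom_id, Category.comp_id, ← Category.assoc c, prod.comp_lift,
      Category.comp_id, comp_zero, hφ Z c 0 _ hb (by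
        rw [← ha', Category.assoc, mapKernel_comp_mapKernel w, comp_zero, zero_comp, zero_comp]),
      ← Category.assoc (a ≫ _) (kernelToP w n)]
    congr 1
    apply pullback.hom_ext
    · simp only [Category.assoc, pullback.lift_fst, ← ha']
    · simp only [Category.assoc, pullback.lift_snd, zero_comp, comp_zero]
  · obtain ⟨a, ha⟩ := h.exists_lift_kernel (b₀ ≫ homologyArrow B n) hb₀'
    refine ⟨_, c₀, b₀ ≫ inv (opcyclesToCokernel B (n + 1)), a ≫ kernelToCycles X n, hc₀, ?_, ?_⟩
    · rw [← cancel_mono (opcyclesToCokernel C (n + 1)), Category.assoc, Category.assoc,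
        Category.assoc, opcyclesMap_opcyclesToCokernel, IsIso.inv_hom_id_assoc, hb₀]
      rfl
    · rw [Category.assoc, kernelToCycles_cyclesMap, reassoc_of% ha,
        ← opcyclesToCokernel_homologyArrow_kernelToCycles, Category.assoc,
        IsIso.inv_hom_id_assoc]
  · simp
  · rw [← Category.id_comp (connecting g n), comp_connecting g n _ (by
        rw [Category.assoc, homologyInclusion_homologyArrow, comp_zero, zero_comp]),
      hφ _ 0 (𝟙 _) 0 (by rw [zero_comp, zero_comp]) (by
        rw [Category.id_comp, homologyInclusion_homologyArrow, zero_comp, zero_comp])]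
    congr 1
    apply pullback.hom_ext
    · rw [pullback.lift_fst, pullback.lift_fst, zero_comp]
    · rw [pullback.lift_snd, pullback.lift_snd]
  -- On the diagonal, with `b₀` over `c₀`, the value of `φ` is the class of `(d b₀, g b₀) = h^P b₀`.
  · rw [← cancel_epi c₀, comp_zero, ← Category.assoc, prod.comp_lift, Category.comp_id,
      hφ _ c₀ c₀ b₀ hb₀ (by
        rw [hb₀', Category.assoc, homologyInclusion_homologyArrow, comp_zero])]
    refine Eq.trans ?_ ((b₀ ≫= arrowP_projP g n).trans comp_zero)
    rw [← Category.assoc b₀]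
    congr 1
    apply pullback.hom_ext
    · simp only [Category.assoc, pullback.lift_fst]
    · simp only [Category.assoc, pullback.lift_snd, hb₀]

end

/-! ### Abelian categories -/

section Abelian

variable {A : Type u} [Category.{v} A] [Abelian A]

theorem regular_of_abelian : Regular A where
  hasCoequalizer_of_isKernelPair _ := inferInstance
  regularEpiIsStableUnderBaseChange :=
    { of_isPullback := fun {X Y Z W f g f' g'} sq hg => by
        have : IsRegularEpi g := hg
        have : Epi g' := Abelian.epi_snd_of_isLimit _ _ sq.isLimit
        exact ⟨⟨regularEpiOfEpi g'⟩⟩ }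

/-- The kernel of `f` lies in the kernel of `p`, hence in the pullback along `v`, where the induced
arrow is monic. Conversely `x' - s' p' x'` is in the kernel of `p'` and lifts through the pullback,
while `s' p' x'` is the image of `s p' x'`; so `f` is split epic. -/
theorem protomodular_of_abelian : Protomodular A where
  isIso_of_isIso_pullback {E B X X'} v p s p' s' f hs hs' hp hf _ := by
    let m := pullback.map p v p' v f (𝟙 E) (𝟙 B) (by simp [hp]) (by simp)
    have hm₁ : m ≫ pullback.fst p' v = pullback.fst p v ≫ f := pullback.lift_fst _ _ _
    have hm₂ : m ≫ pullback.snd p' v = pullback.snd p v :=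
      (pullback.lift_snd _ _ _).trans (Category.comp_id _)
    have hm : IsIso m := inferInstance
    have : Mono f := Preadditive.mono_of_cancel_zero f fun {T} x hx => by
      have hxp : x ≫ p = 0 := by rw [← hp, reassoc_of% hx, zero_comp]
      let t : T ⟶ pullback p v := pullback.lift x 0 (by rw [hxp, zero_comp])
      have ht : t = 0 := by
        rw [← cancel_mono m, zero_comp]
        apply pullback.hom_ext
        · simp only [t, Category.assoc, hm₁, pullback.lift_fst_assoc, hx, zero_comp]
        · simp only [t, Category.assoc, hm₂, pullback.lift_snd, zero_comp]
      rw [← pullback.lift_fst x 0 (by rw [hxp, zero_comp] : x ≫ p = 0 ≫ v)]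
      exact (congrArg (· ≫ pullback.fst p v) ht).trans zero_comp
    let t : X' ⟶ pullback p' v := pullback.lift (𝟙 X' - p' ≫ s') 0 (by simp [hs'])
    have ht : (t ≫ inv m ≫ pullback.fst p v) ≫ f = 𝟙 X' - p' ≫ s' := by
      simp only [Category.assoc, ← hm₁, IsIso.inv_hom_id_assoc, t, pullback.lift_fst]
    have : IsSplitEpi f := ⟨⟨⟨t ≫ inv m ≫ pullback.fst p v + p' ≫ s, by
      simp [Preadditive.add_comp, Category.assoc, ← hm₁, t, pullback.lift_fst, hf]⟩⟩⟩
    exact isIso_of_mono_of_epi f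

theorem isProperArrow_of_abelian {X Y : A} (f : X ⟶ Y) : IsProperArrow f :=
  have : Epi (kernel.lift (cokernel.π f) f (cokernel.condition f)) :=
    inferInstanceAs (Epi (Abelian.factorThruImage f))
  ⟨⟨regularEpiOfEpi _⟩⟩

theorem isExtension_of_shortExact {S : ShortComplex (ChainComplex A ℤ)} (hS : S.ShortExact) :
    IsExtension S.f S.g := fun n => by
  have h := hS.map_of_exact (HomologicalComplex.eval A (ComplexShape.down ℤ) n)
  exact ⟨by rw [← HomologicalComplex.comp_f, S.zero]; rfl, ⟨h.fIsKernel⟩, ⟨h.gIsCokernel⟩⟩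

/-- The diagonal is the sum of the two inclusions of the factors. -/
theorem AreMutuallyInverse.eq_neg {Z W : A} {a b : Z ⟶ W} (h : AreMutuallyInverse a b) :
    a = - b := by
  obtain ⟨φ, rfl, rfl, h⟩ := h
  rw [eq_neg_iff_add_eq_zero, ← Preadditive.add_comp, ← h]
  congr 1
  apply prod.hom_ext
  · simp only [Preadditive.add_comp, prod.lift_fst, add_zero]
  · simp only [Preadditive.add_comp, prod.lift_snd, zero_add]

/-- On the covering `c` of the homology both arrows are computed by the same lift `b` and cycle `a`,
and `c` is epic. -/
theorem IsClassicalConnecting.eq_δ {S : ShortComplex (ChainComplex A ℤ)} (hS : S.ShortExact)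
    {n : ℤ} {del : S.X₃.homology (n + 1) ⟶ S.X₁.homology n}
    (h : IsClassicalConnecting S.f S.g n del) : del = hS.δ (n + 1) n rfl := by
  obtain ⟨h, Z, c, b, a, hc, hcb, hab⟩ := h
  rw [← cancel_epi c, h Z c b a hcb hab]
  exact (hS.δ_eq' (n + 1) n rfl c b a hcb.symm hab).symm

end Abelian

end SnailHomology

/-! ### The main theorem -/

open SnailHomology in
theorem mainTheorem1 :
    (∀ (A : Type u) [Category.{v} A] [HasZeroObject A] [HasZeroMorphisms A] [HasCokernels A]
        [Regular A] [Protomodular A],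
      (∀ (B C : ChainComplex A ℤ) (g : B ⟶ C), IsProperComplex B → IsProperComplex C →
        (SeqFamily.thetaKernel (toSeq.map g)).IsProper →
        ∃ (_ : ∀ n : ℤ, B.HasHomology n) (_ : ∀ n : ℤ, C.HasHomology n), IsLongExact g) ∧
      (∀ (X B C : ChainComplex A ℤ) (f : X ⟶ B) (g : B ⟶ C) (w : f ≫ g = 0),
        IsExtension f g → IsProperComplex X → IsProperComplex B → IsProperComplex C →
        (SeqFamily.thetaKernel (toSeq.map g)).IsProper →
        ∃ (_ : ∀ n : ℤ, X.HasHomology n) (_ : ∀ n : ℤ, B.HasHomology n)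
          (_ : ∀ n : ℤ, C.HasHomology n) (e : ∀ n : ℤ, X.homology n ≅ cokerP g n)
          (del : ∀ n : ℤ, C.homology (n + 1) ⟶ X.homology n),
          IsInducedByComparison f g w e ∧
          ∀ n : ℤ, IsClassicalConnecting f g n (del n) ∧
            AreMutuallyInverse (del n ≫ (e n).hom) (connecting g n))) ∧
    (∀ (A : Type u) [Category.{v} A] [Abelian A],
      (∀ (B C : ChainComplex A ℤ) (g : B ⟶ C), IsLongExact g) ∧
      (∀ (S : ShortComplex (ChainComplex A ℤ)) (hS : S.ShortExact),
        ∃ e : ∀ n : ℤ, S.X₁.homology n ≅ cokerP S.g n,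
          IsInducedByComparison S.f S.g S.zero e ∧
          ∀ n : ℤ, hS.δ (n + 1) n rfl ≫ (e n).hom = - connecting S.g n)) := by
  refine ⟨?_, ?_⟩
  · intro A _ _ _ _ _ _
    refine ⟨fun B C g hB hC hP => ?_, fun X B C f g w h hX hB hC hP => ?_⟩
    · exact ⟨hB.hasHomology, hC.hasHomology,
        have := hB.hasHomology
        have := hC.hasHomology
        isLongExact_of_isProper g hB hC hP⟩
    · have := hX.hasHomology
      have := hB.hasHomology
      have := hC.hasHomology
      choose e he using fun n => h.exists_iso_cokerP w hC hP n
      choose del hdel using fun n => h.exists_isClassicalConnecting w n (e n) (he n)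
      exact ⟨inferInstance, inferInstance, inferInstance, e, del,
        isInducedByComparison_of_cyclesClass w e he, hdel⟩
  · intro A _ _
    have := regular_of_abelian (A := A)
    have := protomodular_of_abelian (A := A)
    refine ⟨fun B C g => ?_, fun S hS => ?_⟩
    · exact isLongExact_of_isProper g (fun n => isProperArrow_of_abelian _)
        (fun n => isProperArrow_of_abelian _) (fun n => isProperArrow_of_abelian _)
    · have h := isExtension_of_shortExact hS
      choose e he using fun n => h.exists_iso_cokerP S.zero
        (fun n => isProperArrow_of_abelian _) (fun n => isProperArrow_of_abelian _) n
      refine ⟨e, isInducedByComparison_of_cyclesClass S.zero e he, fun n => ?_⟩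
      obtain ⟨del, hdel, hinv⟩ := h.exists_isClassicalConnecting S.zero n (e n) (he n)
      rw [← hdel.eq_δ hS]
      exact hinv.eq_neg
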